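/- **Terms.** Simple types are built from a set $\mathcal S$ of sorts by $\to$; every type is $A_1\to\cdots\to A_n\to B$ with $B\in\mathcal S$. Terms are the typable applicative terms over typed function symbols $\mathcal F$ and typed variables $\mathcal V$ (infinitely many of each type); $\mathrm{Var}(t)$ is the set of variables of $t$. Write $s\trianglerighteq t$ if $s=t$, or $s=s_0s_1$ with $s_1\trianglerighteq t$, or $s=s_0s_1$ with $s_0\trianglerighteq t$ and $s_0\ne t$; $s\vartriangleright t$ means $s\trianglerighteq t$ and $s\neq t$. Substitutions are type-preserving maps from variables to terms. There are theory sorts $\mathcal S_\vartheta\subseteq\mathcal S$ and theory symbols $\mathcal F_\vartheta\subseteq\mathcal F$, each of a type $A_1\to\cdots\to A_n\to B$ with all $A_i,B\in\mathcal S_\vartheta$; theory terms are terms over $\mathcal F_\vartheta$ and $\mathcal V$; values are theory symbols whose type is a sort. Theory symbols have an interpretation $[\![\cdot]\!]$ in sets $(\mathfrak X_A)_{A\in\mathcal S_\vartheta}$ (arrow types denoting sets of functions), bijective from the values of type $A$ to $\mathfrak X_A$ for each $A\in\mathcal S_\vartheta$, and extended to ground theory terms; $\mathsf{bool}\in\mathcal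 S_\vartheta$, $\mathfrak X_{\mathsf{bool}}=\{0,1\}$. A logical constraint is a theory term of type $\mathsf{bool}$ all of whose variables have theory sorts. **Systems.** A rule $\ell\to r\,[\varphi]$ consists of terms $\ell,r$ of the same type and a logical constraint $\varphi$ such that variables in $\mathrm{Var}(r)\setminus\mathrm{Var}(\ell)$ have theory sorts, $\ell=f\,t_1\cdots t_n$ for a function symbol $f$ ($f$ is then called defined), every $s$ with $\ell\trianglerighteq s$ is a variable or has a function symbol at its head, and $\ell$ contains a symbol outside $\mathcal F_\vartheta$. An LCSTRS $\mathcal R$ is given by the above data and a set of rules. Its rewrite relation $\to_{\mathcal R}$ is the closure under contexts of: (i) $\ell\sigma\to r\sigma$ for rules $\ell\to r\,[\varphi]$ such that $\sigma(x)$ is a value for all $x\in\mathrm{Var}(\varphi)\cup(\mathrm{Var}(r)\setminus\mathrm{Var}(\ell))$ and $[\![\varphi\sigma]\!]=1$; (ii) calculations $f\,v_1\cdots v_n\to v'$ with $f\in\mathcal F_\vartheta$, $n>0$, values $v_i,v'$ and $[\![f\,v_1\cdots v_n]\!]=[\![v']\!]$. The closure of (ii) alone is $\to_\kappa$; $t{\downarrow}_\kappa$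 is the unique $\kappa$-normal form. **Computability.** Let $\succsim$ be a sort ordering: a quasi-ordering on $\mathcal S$ with well-founded strict part $\succ$. For a sort $A$ and a type $B=B_1\to\cdots\to B_n\to C$ with $C$ a sort, put $A\succsim_+B$ iff $A\succsim C$ and $A\succ_-B_i$ for all $i$, and $A\succ_-B$ iff $A\succ C$ and $A\succsim_+B_i$ for all $i$. Position $i$ of $f:A_1\to\cdots\to A_n\to B$ is accessible iff $B\succsim_+A_i$. For a family $I=(I_A)_{A\in\mathcal S}$ of sets of terms, a term of sort $A$ is $I$-computable iff it is in $I_A$, and $t:A\to B$ is $I$-computable iff $t\,u$ is for every $I$-computable $u:A$. Let $s\Rrightarrow_I t$ iff $s,t$ have base types, $s=f\,s_1\cdots s_m$, $t=s_k\,t_1\cdots t_n$ with $k$ accessible in $f$ and all $t_i$ $I$-computable. $\mathbb C$ is the family satisfying: $t\in\mathbb C_A$ iff $t:A$ terminates with respect to ${\to_{\mathcal R}}\cup{\Rrightarrow_{\mathbb C}}$ and whenever $t\to_{\mathcal R}^*f\,t_1\cdots t_n$, every $t_i$ with $i$ accessible in $f$ is $\mathbb C$-computable; it is constructed by well-founded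 recursion along $\succ$, as the least such family on each class of equivalent sorts. **Dependency pairs.** Add a fresh sort $\mathsf{dp}$ and, for each defined $f:A_1\to\cdots\to A_n\to B$ ($B$ a sort), a symbol $f^\sharp:A_1\to\cdots\to A_n\to\mathsf{dp}$. An SDP is $s^\sharp\Rightarrow t^\sharp\,[\varphi\mid L]$ with $s^\sharp=f^\sharp s_1\cdots s_n$, $t^\sharp=g^\sharp t_1\cdots t_m$ of type $\mathsf{dp}$ (also write $s=f\,s_1\cdots s_n$, $t=g\,t_1\cdots t_m$), $\varphi$ a logical constraint and $L\supseteq\mathrm{Var}(\varphi)$ a set of variables of theory sorts. A DP problem $\mathcal P$ is a set of SDPs. A $(\mathcal P,\mathcal R)$-chain is a finite or infinite sequence of pairs $(s_i^\sharp\Rightarrow t_i^\sharp\,[\varphi_i\mid L_i],\sigma_i)$ with SDPs from $\mathcal P$ such that $\sigma_i(x)$ is a ground theory term for all $x\in L_i$, $[\![\varphi_i\sigma_i]\!]=1$, and $t_{i-1}^\sharp\sigma_{i-1}\to_{\mathcal R}^*s_i^\sharp\sigma_i$ for $i>0$; it is computable if $u\sigma_i$ is $\mathbb C$-computable whenever $t_i\vartriangleright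 u$. $\mathcal P$ is finite if there is no infinite computable $(\mathcal P,\mathcal R)$-chain. A DP processor $\rho$ is a partial map from DP problems to sets of DP problems; it is sound if, whenever $\rho(\mathcal P)$ is defined and consists of finite DP problems, $\mathcal P$ is finite. Let $\mathrm{heads}(\mathcal P)$ be the set of symbols $f^\sharp$ heading a side of an SDP in $\mathcal P$. **Theorem.** Let $\mathcal R$ be an LCSTRS with a sort ordering. A DP processor is sound if it belongs to one of the following classes. In 2, 3 and 5, $\rho(\mathcal P)$, whenever defined, is $\{\mathcal P\setminus\mathcal P'\}$ for some non-empty $\mathcal P'\subseteq\mathcal P$ with the stated property. 1. *Graph processors*: whenever $\rho(\mathcal P)$ is defined, there are a finite directed graph $G$ and a map $\theta$ from $\mathcal P$ to its vertices, with an edge from $\theta(p_0)$ to $\theta(p_1)$ whenever $(p_0,\sigma_0),(p_1,\sigma_1)$ is a $(\mathcal P,\mathcal R)$-chain for some $\sigma_0,\sigma_1$, such that $\rho(\mathcal P)=\{\{p\in\mathcal P\mid\theta(p)\in S\}\mid S$ a non-trivial SCC of $G\}$, where an SCC is non-trivial if it contains an edge. 2. *Subterm criterion processors*: there is a choice of an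 argument position $\nu(f^\sharp)$ for each $f^\sharp\in\mathrm{heads}(\mathcal P)$ such that, with $\bar\nu(f^\sharp t_1\cdots t_n)=t_{\nu(f^\sharp)}$, $\bar\nu(s^\sharp)\vartriangleright\bar\nu(t^\sharp)$ for all SDPs in $\mathcal P'$ and $\bar\nu(s^\sharp)=\bar\nu(t^\sharp)$ for all SDPs in $\mathcal P\setminus\mathcal P'$. 3. *Integer mapping processors* (assuming a theory sort $\mathsf{int}$ interpreted as $\mathbb Z$ and theory symbols $\ge,>,\wedge$ with their standard interpretation): for $f^\sharp\in\mathrm{heads}(\mathcal P)$, let $X(f^\sharp)$ be the set of positions $i$ whose argument type is a theory sort and such that the $i$-th argument of any occurrence of $f^\sharp$ in an SDP $s^\sharp\Rightarrow t^\sharp\,[\varphi\mid L]\in\mathcal P$ is a theory term with variables in $L$. There are theory terms $\mathcal J(f^\sharp):\mathsf{int}$ whose variables are among fresh variables $x_{f^\sharp,i}$, $i\in X(f^\sharp)$, of the corresponding argument types, such that, with $\bar{\mathcal J}(f^\sharp t_1\cdots t_n)=\mathcal J(f^\sharp)[x_{f^\sharp,i}:=t_i]_{i\in X(f^\sharp)}$,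 $\varphi\models\bar{\mathcal J}(s^\sharp)\ge0\wedge\bar{\mathcal J}(s^\sharp)>\bar{\mathcal J}(t^\sharp)$ for all SDPs in $\mathcal P'$ and $\varphi\models\bar{\mathcal J}(s^\sharp)\ge\bar{\mathcal J}(t^\sharp)$ for all SDPs in $\mathcal P\setminus\mathcal P'$. Here $\varphi\models\varphi'$ means that $[\![\varphi\sigma]\!]=1$ implies $[\![\varphi'\sigma]\!]=1$ for all $\sigma$ mapping $\mathrm{Var}(\varphi)\cup\mathrm{Var}(\varphi')$ to values. 4. *Theory argument processors*: whenever $\rho(\mathcal P)$ is defined, there are a non-empty $\mathcal P'\subseteq\mathcal P$ and a map $\tau$ from $\mathrm{heads}(\mathcal P)$ to sets of argument positions whose types are theory sorts such that, for each SDP $f^\sharp s_1\cdots s_m\Rightarrow g^\sharp t_1\cdots t_n\,[\varphi\mid L]\in\mathcal P$: $s_i$ is a theory term with variables of theory sorts for $i\in\tau(f^\sharp)$; $t_j$ is a theory term with $\mathrm{Var}(t_j)\subseteq L\cup\bigcup_{i\in\tau(f^\sharp)}\mathrm{Var}(s_i)$ for $j\in\tau(g^\sharp)$; and $\bigcup_{j\in\tau(g^\sharp)}\mathrm{Var}(t_j)\subseteq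 L$ if the SDP is in $\mathcal P'$. Moreover $\rho(\mathcal P)=\{\{\bar\tau(p)\mid p\in\mathcal P\},\mathcal P\setminus\mathcal P'\}$, where $\bar\tau$ replaces $L$ by $L\cup\bigcup_{i\in\tau(f^\sharp)}\mathrm{Var}(s_i)$. 5. *Constrained reduction pair processors*: a constrained relation is a set of quadruples $(s,t,\varphi,L)$ of terms $s,t$ (possibly with marked symbols) of the same type, a logical constraint $\varphi$ and a set $L\supseteq\mathrm{Var}(\varphi)$ of variables of theory sorts. It is covered by a binary relation $R'$ on terms if $(s\sigma){\downarrow}_\kappa\mathrel{R'}(t\sigma){\downarrow}_\kappa$ for all its quadruples and all $\sigma$ with $\sigma(x)$ a ground theory term for $x\in L$ and $[\![\varphi\sigma]\!]=1$. There are constrained relations $\succeq,\succ$ covered by relations $\sqsupseteq,\sqsupset$ respectively, where $\sqsupseteq$ is reflexive, closed under contexts and includes $\to_\kappa$, $\sqsupset$ is well-founded, and $s\sqsupseteq t\sqsupset u$ implies $s\sqsupset^+u$, such that $(s^\sharp,t^\sharp,\varphi,L)$ is in $\succ$ for all SDPs in $\mathcal P'$, in $\succeq$ for all SDPs in $\mathcal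 P\setminus\mathcal P'$, and $(\ell,r,\varphi,\mathrm{Var}(\varphi)\cup(\mathrm{Var}(r)\setminus\mathrm{Var}(\ell)))$ is in $\succeq$ for all rules $\ell\to r\,[\varphi]$ of $\mathcal R$. -/

import Mathlib

universe u v w x

/-! ## Simple types -/

/-- Simple types over a set `S` of sorts. -/
inductive Ty (S : Type u) : Type u
  | base (s : S) : Ty S
  | arrow (A B : Ty S) : Ty S

namespace Ty

/-- The argument types `A₁, …, Aₙ` of `A₁ → ⋯ → Aₙ → B` with `B` a sort. -/
def argTys {S : Type u} : Ty S → List (Ty S)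
  | base _ => []
  | arrow A B => A :: B.argTys

/-- The sort `B` of `A₁ → ⋯ → Aₙ → B`. -/
def target {S : Type u} : Ty S → S
  | base s => s
  | arrow _ B => B.target

/-- Theory types over a set `T` of theory sorts. -/
def IsTheory {S : Type u} (T : Set S) : Ty S → Prop
  | base s => s ∈ T
  | arrow A B => (∃ s ∈ T, A = base s) ∧ B.IsTheory T

/-- `A` is (the type of) a theory sort. -/
def IsTheorySort {S : Type u} (T : Set S) (A : Ty S) : Prop := ∃ s ∈ T, A = base s

/-- The family `X` of carriers extended to types: arrows denote sets of mappings. Only its values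
at theory types matter. -/
def denote {S : Type u} (X : S → Type x) : Ty S → Type x
  | base s => X s
  | arrow A B => denote X A → denote X B

/-- A type over `S`, seen as a type over `S ∪ {dp}`. -/
def lift {S : Type u} : Ty S → Ty (Option S)
  | base s => base (some s)
  | arrow A B => arrow A.lift B.lift

/-- `A₁ → ⋯ → Aₙ → dp` for the type `A₁ → ⋯ → Aₙ → B` with `B` a sort; `dp` is `none`. -/
def sharp {S : Type u} : Ty S → Ty (Option S)
  | base _ => base none
  | arrow A B => arrow A.lift B.sharp

end Ty

/-! ## Terms, contexts, subterms -/

/-- Pre-terms over function symbols `F` and variables `V`. -/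
inductive PreTerm (F : Type v) (V : Type w) : Type (max v w)
  | sym (f : F) : PreTerm F V
  | var (y : V) : PreTerm F V
  | app (t₀ t₁ : PreTerm F V) : PreTerm F V

/-- One-hole contexts. -/
inductive Ctx (F : Type v) (V : Type w) : Type (max v w)
  | hole : Ctx F V
  | appL (C : Ctx F V) (t : PreTerm F V) : Ctx F V
  | appR (t : PreTerm F V) (C : Ctx F V) : Ctx F V

/-- `C[t]`. -/
def Ctx.fill {F : Type v} {V : Type w} : Ctx F V → PreTerm F V → PreTerm F V
  | hole, t => t
  | appL C u, t => .app (C.fill t) u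
  | appR u C, t => .app u (C.fill t)

namespace PreTerm

/-- `t t₁ ⋯ tₙ`. -/
def apps {F : Type v} {V : Type w} (t : PreTerm F V) (ts : List (PreTerm F V)) : PreTerm F V :=
  ts.foldl app t

/-- The function symbols of a term. -/
def syms {F : Type v} {V : Type w} : PreTerm F V → Set F
  | sym f => {f}
  | var _ => ∅
  | app t₀ t₁ => t₀.syms ∪ t₁.syms

/-- The variables of a term. -/
def vars {F : Type v} {V : Type w} : PreTerm F V → Set V
  | sym _ => ∅
  | var y => {y}
  | app t₀ t₁ => t₀.vars ∪ t₁.vars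

/-- Application `t σ` of a mapping `σ` from variables to terms. -/
def subst {F : Type v} {V : Type w} {W : Type x} (σ : V → PreTerm F W) :
    PreTerm F V → PreTerm F W
  | sym f => sym f
  | var y => σ y
  | app t₀ t₁ => app (t₀.subst σ) (t₁.subst σ)

/-- Replacement of function symbols along a mapping. -/
def mapSym {F : Type v} {V : Type w} {G : Type x} (e : F → G) : PreTerm F V → PreTerm G V
  | sym f => sym (e f)
  | var y => var y
  | app t₀ t₁ => app (t₀.mapSym e) (t₁.mapSym e)

/-- The typing relation `t : A`. Terms are the pre-terms that have a type. -/
inductive HasType {S : Type u} {F : Type v} {V : Type w} (symTy : F → Ty S) (varTy : V → Ty S) :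
    PreTerm F V → Ty S → Prop
  | sym (f : F) : HasType symTy varTy (sym f) (symTy f)
  | var (y : V) : HasType symTy varTy (var y) (varTy y)
  | app {t₀ t₁ : PreTerm F V} {A B : Ty S} (h₀ : HasType symTy varTy t₀ (.arrow A B))
      (h₁ : HasType symTy varTy t₁ A) : HasType symTy varTy (app t₀ t₁) B

/-- `Subterm s t` says that `t` is a (maximally applied) subterm of `s`. -/
inductive Subterm {F : Type v} {V : Type w} : PreTerm F V → PreTerm F V → Prop
  | refl (s : PreTerm F V) : Subterm s s
  | arg {s₀ s₁ t : PreTerm F V} (h : Subterm s₁ t) : Subterm (app s₀ s₁) t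
  | head {s₀ s₁ t : PreTerm F V} (h : Subterm s₀ t) (hne : s₀ ≠ t) : Subterm (app s₀ s₁) t

/-- `t` is a proper (maximally applied) subterm of `s`. -/
def ProperSubterm {F : Type v} {V : Type w} (s t : PreTerm F V) : Prop := Subterm s t ∧ s ≠ t

/-- A pattern: every subterm is of the form `f t₁ ⋯ tₙ` or a variable. -/
def IsPattern {F : Type v} {V : Type w} (t : PreTerm F V) : Prop :=
  ∀ s, Subterm t s → (∃ f ts, s = apps (sym f) ts) ∨ ∃ y, s = var y

/-- A neutral term `y t₁ ⋯ tₙ`. -/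
def IsNeutral {F : Type v} {V : Type w} (t : PreTerm F V) : Prop := ∃ y ts, t = apps (var y) ts

end PreTerm

open PreTerm

/-- The closure of a relation under contexts. -/
def CtxClosure {F : Type v} {V : Type w} (r : PreTerm F V → PreTerm F V → Prop)
    (t t' : PreTerm F V) : Prop :=
  ∃ (C : Ctx F V) (a b : PreTerm F V), r a b ∧ t = C.fill a ∧ t' = C.fill b

/-- `a` is terminating: there is no infinite `r`-sequence starting from `a`. -/
def Terminating {α : Type u} (r : α → α → Prop) (a : α) : Prop := Acc (fun b c => r c b) a

/-! ## Theories and LCSTRSs -/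

/-- Sorts, symbols, variables and an interpretation of theory symbols, without the laws. The
carriers `Dom s` matter only for theory sorts `s`. -/
structure PreSignature (S : Type u) (F : Type v) (V : Type w) where
  symTy : F → Ty S
  varTy : V → Ty S
  theorySorts : Set S
  theorySyms : Set F
  theorySyms_ty : ∀ f ∈ theorySyms, (symTy f).IsTheory theorySorts
  Dom : S → Type x
  interp : (f : F) → f ∈ theorySyms → (symTy f).denote Dom

namespace PreSignature

variable {S : Type u} {F : Type v} {V : Type w}

/-- `t : A` for pre-terms over the signature. -/
abbrev HasTy (G : PreSignature.{u, v, w, x} S F V) (t : PreTerm F V) (A : Ty S) : Prop :=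
  HasType G.symTy G.varTy t A

/-- `G.Eval t A a` says that `t` is a ground theory term of type `A` with `⟦t⟧ = a`. -/
inductive Eval (G : PreSignature.{u, v, w, x} S F V) :
    PreTerm F V → (A : Ty S) → A.denote G.Dom → Prop
  | sym (f : F) (hf : f ∈ G.theorySyms) : Eval G (sym f) (G.symTy f) (G.interp f hf)
  | app {t₀ t₁ : PreTerm F V} {A B : Ty S} {g : A.denote G.Dom → B.denote G.Dom}
      {a : A.denote G.Dom} (h₀ : Eval G t₀ (.arrow A B) g) (h₁ : Eval G t₁ A a) :
      Eval G (app t₀ t₁) B (g a)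

/-- A value: a theory symbol whose type is a (theory) sort. -/
def IsValueSym (G : PreSignature.{u, v, w, x} S F V) (f : F) : Prop :=
  f ∈ G.theorySyms ∧ ∃ s, G.symTy f = .base s

/-- The term is a value. -/
def IsValue (G : PreSignature.{u, v, w, x} S F V) (t : PreTerm F V) : Prop :=
  ∃ f, t = sym f ∧ G.IsValueSym f

/-- Theory terms. -/
def IsTheoryTerm (G : PreSignature.{u, v, w, x} S F V) (t : PreTerm F V) : Prop :=
  (∃ A, G.HasTy t A) ∧ t.syms ⊆ G.theorySyms

/-- Ground theory terms. -/
def IsGroundTheoryTerm (G : PreSignature.{u, v, w, x} S F V) (t : PreTerm F V) : Prop :=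
  G.IsTheoryTerm t ∧ t.vars = ∅

/-- The type of the variable is a theory sort. -/
def IsTheoryVar (G : PreSignature.{u, v, w, x} S F V) (y : V) : Prop :=
  (G.varTy y).IsTheorySort G.theorySorts

/-- Substitutions: type-preserving mappings from variables to terms. -/
def IsSubst (G : PreSignature.{u, v, w, x} S F V) (σ : V → PreTerm F V) : Prop :=
  ∀ y, G.HasTy (σ y) (G.varTy y)

end PreSignature

/-- A signature with an interpretation of theory symbols. The carrier of `bool` is identified with
`{0, 1}` through `boolEquiv`. -/
structure Signature (S : Type u) (F : Type v) (V : Type w) extends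
    PreSignature.{u, v, w, x} S F V where
  /-- There are infinitely many variables of each type. -/
  infinite_vars : ∀ A : Ty S, {y : V | varTy y = A}.Infinite
  /-- For each theory sort `s`, the interpretation is a bijection from the values of type `s` to
  the carrier of `s`. -/
  interp_bijective : ∀ s ∈ theorySorts, ∀ a : Dom s,
    ∃! f : F, toPreSignature.IsValueSym f ∧ toPreSignature.Eval (sym f) (.base s) a
  bool : S
  bool_mem : bool ∈ theorySorts
  boolEquiv : Dom bool ≃ Bool
  ff : F
  tt : F
  ff_eval : toPreSignature.Eval (sym ff) (.base bool) (boolEquiv.symm false)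
  tt_eval : toPreSignature.Eval (sym tt) (.base bool) (boolEquiv.symm true)

/-- The triple `ℓ → r [φ]`. -/
structure Rule (F : Type v) (V : Type w) where
  lhs : PreTerm F V
  rhs : PreTerm F V
  cond : PreTerm F V

namespace Signature

variable {S : Type u} {F : Type v} {V : Type w}

/-- Logical constraints. -/
def IsConstraint (G : Signature.{u, v, w, x} S F V) (φ : PreTerm F V) : Prop :=
  G.IsTheoryTerm φ ∧ G.HasTy φ (.base G.bool) ∧ ∀ y ∈ φ.vars, G.IsTheoryVar y

/-- `⟦t⟧ = 1`. -/
def IsTrue (G : Signature.{u, v, w, x} S F V) (t : PreTerm F V) : Prop :=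
  G.Eval t (.base G.bool) (G.boolEquiv.symm true)

/-- Constrained rewrite rules. -/
structure IsRule (G : Signature.{u, v, w, x} S F V) (ρ : Rule F V) : Prop where
  same_type : ∃ A, G.HasTy ρ.lhs A ∧ G.HasTy ρ.rhs A
  cond : G.IsConstraint ρ.cond
  fresh_vars : ∀ y ∈ ρ.rhs.vars \ ρ.lhs.vars, G.IsTheoryVar y
  pattern : ρ.lhs.IsPattern
  head : ∃ f ts, ρ.lhs = apps (sym f) ts
  non_theory : ∃ f ∈ ρ.lhs.syms, f ∉ G.theorySyms

/-- `φ ⊨ φ'`. -/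
def Entails (G : Signature.{u, v, w, x} S F V) (φ φ' : PreTerm F V) : Prop :=
  ∀ σ, G.IsSubst σ → (∀ y ∈ φ.vars ∪ φ'.vars, G.IsValue (σ y)) →
    G.IsTrue (φ.subst σ) → G.IsTrue (φ'.subst σ)

end Signature

/-- Logically constrained simply-typed term rewriting systems. -/
structure LCSTRS (S : Type u) (F : Type v) (V : Type w) extends Signature.{u, v, w, x} S F V where
  rules : Set (Rule F V)
  isRule : ∀ ρ ∈ rules, toSignature.IsRule ρ

/-- A sort ordering: a quasi-ordering on sorts with well-founded strict part. -/
structure SortOrdering (S : Type u) where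
  ge : S → S → Prop
  refl : ∀ s, ge s s
  trans : ∀ s t r, ge s t → ge t r → ge s r
  wf : WellFounded (fun s t => ge t s ∧ ¬ ge s t)

namespace SortOrdering

variable {S : Type u}

/-- The strict part. -/
def gt (o : SortOrdering S) (s t : S) : Prop := o.ge s t ∧ ¬ o.ge t s

mutual
/-- `a ≿₊ B`. -/
def posGe (o : SortOrdering S) (a : S) : Ty S → Prop
  | .base c => o.ge a c
  | .arrow A B => o.negGt a A ∧ o.posGe a B
/-- `a ≻₋ B`. -/
def negGt (o : SortOrdering S) (a : S) : Ty S → Prop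
  | .base c => o.gt a c
  | .arrow A B => o.posGe a A ∧ o.negGt a B
end

end SortOrdering

namespace LCSTRS

variable {S : Type u} {F : Type v} {V : Type w}

/-! ## Rewriting -/

/-- `σ` respects the rule `ρ`. -/
def Respects (R : LCSTRS.{u, v, w, x} S F V) (ρ : Rule F V) (σ : V → PreTerm F V) : Prop :=
  (∀ y ∈ ρ.cond.vars ∪ (ρ.rhs.vars \ ρ.lhs.vars), R.IsValue (σ y)) ∧ R.IsTrue (ρ.cond.subst σ)

/-- Rule instances `(ℓ σ, r σ)` at the root. -/
def RuleStep (R : LCSTRS.{u, v, w, x} S F V) (t t' : PreTerm F V) : Prop :=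
  ∃ ρ ∈ R.rules, ∃ σ, R.IsSubst σ ∧ R.Respects ρ σ ∧ t = ρ.lhs.subst σ ∧ t' = ρ.rhs.subst σ

/-- Calculations `f v₁ ⋯ vₙ → v'` at the root. -/
def CalcStep (R : LCSTRS.{u, v, w, x} S F V) (t t' : PreTerm F V) : Prop :=
  ∃ f ∈ R.theorySyms, ∃ vs : List (PreTerm F V), vs ≠ [] ∧ (∀ c ∈ vs, R.IsValue c) ∧
    t = apps (sym f) vs ∧ R.IsValue t' ∧ ∃ s a, R.Eval t (.base s) a ∧ R.Eval t' (.base s) a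

/-- The rewrite relation of `R` (on terms without marked symbols). -/
def Rew (R : LCSTRS.{u, v, w, x} S F V) : PreTerm F V → PreTerm F V → Prop :=
  CtxClosure fun t t' => R.RuleStep t t' ∨ R.CalcStep t t'

/-- `f` is a defined symbol. -/
def Defined (R : LCSTRS.{u, v, w, x} S F V) (f : F) : Prop :=
  ∃ ρ ∈ R.rules, ∃ ts, ρ.lhs = apps (sym f) ts

/-! ## Computability -/

/-- `I`-computable terms of a given type, for a family `I` of sets of terms indexed by sorts. -/
def CompAt (R : LCSTRS.{u, v, w, x} S F V) (I : S → Set (PreTerm F V)) :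
    Ty S → PreTerm F V → Prop
  | .base s, t => R.HasTy t (.base s) ∧ t ∈ I s
  | .arrow A B, t => R.HasTy t (.arrow A B) ∧ ∀ u, R.CompAt I A u → R.CompAt I B (.app t u)

/-- `I`-computable terms. -/
def Comp (R : LCSTRS.{u, v, w, x} S F V) (I : S → Set (PreTerm F V)) (t : PreTerm F V) : Prop :=
  ∃ A, R.CompAt I A t

/-- The argument position `i` (counted from 0) of `f` is accessible. -/
def AccPos (R : LCSTRS.{u, v, w, x} S F V) (o : SortOrdering S) (f : F) (i : ℕ) : Prop :=
  ∃ A, (R.symTy f).argTys[i]? = some A ∧ o.posGe (R.symTy f).target A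

/-- `s ⇛_I t`. -/
def AccStep (R : LCSTRS.{u, v, w, x} S F V) (o : SortOrdering S) (I : S → Set (PreTerm F V))
    (s t : PreTerm F V) : Prop :=
  (∃ a, R.HasTy s (.base a)) ∧ (∃ b, R.HasTy t (.base b)) ∧
    ∃ f ss k sk ts, s = apps (sym f) ss ∧ R.AccPos o f k ∧ ss[k]? = some sk ∧
      t = apps sk ts ∧ ∀ ti ∈ ts, R.Comp I ti

/-- The terms `t` of sort `a` that terminate with respect to `→ ∪ ⇛_I` and are such that, whenever
`t →* f t₁ ⋯ tₙ`, all the `tᵢ` at accessible positions of `f` are `I`-computable. -/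
def candStep (R : LCSTRS.{u, v, w, x} S F V) (o : SortOrdering S) (I : S → Set (PreTerm F V))
    (a : S) : Set (PreTerm F V) :=
  {t | R.HasTy t (.base a) ∧ Terminating (fun s s' => R.Rew s s' ∨ R.AccStep o I s s') t ∧
    ∀ f ts, Relation.ReflTransGen R.Rew t (apps (sym f) ts) →
      ∀ i ti, ts[i]? = some ti → R.AccPos o f i → R.Comp I ti}

/-- A set of reducibility candidates (RC-set) for the rewrite relation of `R`. -/
structure IsRCSet (R : LCSTRS.{u, v, w, x} S F V) (I : S → Set (PreTerm F V)) : Prop where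
  terminating : ∀ a, ∀ t ∈ I a, R.HasTy t (.base a) ∧ Terminating R.Rew t
  closed : ∀ a, ∀ s ∈ I a, ∀ t, R.Rew s t → t ∈ I a
  neutral : ∀ a s, R.HasTy s (.base a) → s.IsNeutral → (∀ t, R.Rew s t → t ∈ I a) → s ∈ I a

open Classical in
/-- The family that is `J` at sorts below `a`, `I` at sorts equivalent to `a`, empty elsewhere. -/
noncomputable def glue (o : SortOrdering S) (a : S)
    (J : (b : S) → o.ge a b ∧ ¬ o.ge b a → Set (PreTerm F V)) (I : S → Set (PreTerm F V)) (b : S) :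
    Set (PreTerm F V) :=
  if h : o.ge a b ∧ ¬ o.ge b a then J b h else if o.ge a b ∧ o.ge b a then I b else ∅

/-- The RC-set `ℂ`, by well-founded recursion on sorts: given `ℂ` at the sorts below `a`, the
restriction of `ℂ` to the sorts equivalent to `a` is the least family closed under `candStep`.
That it is an RC-set with the required fixed-point property is proved in `candSet_isRCSet` and
`mem_candSet_iff` below. -/
noncomputable def candSet (R : LCSTRS.{u, v, w, x} S F V) (o : SortOrdering S) :
    S → Set (PreTerm F V) :=
  o.wf.fix fun a J =>
    {t | ∀ I : S → Set (PreTerm F V),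
      (∀ b, o.ge a b → o.ge b a → R.candStep o (glue o a J I) b ⊆ I b) → t ∈ I a}

/-! ### The defining properties of `ℂ` -/

theorem apps_snoc (t : PreTerm F V) (ts : List (PreTerm F V)) (u : PreTerm F V) :
    apps t (ts ++ [u]) = app (apps t ts) u := by simp [apps]

theorem apps_var_ne_apps_sym (y : V) (f : F) (ts ss : List (PreTerm F V)) :
    apps (var y) ts ≠ apps (sym f) ss := by
  induction ts using List.reverseRecOn generalizing ss with
  | nil =>
    induction ss using List.reverseRecOn with
    | nil => simp [apps]
    | append_singleton ss u _ => simp [apps]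
  | append_singleton ts u ih =>
    induction ss using List.reverseRecOn with
    | nil => simp [apps]
    | append_singleton ss u' _ =>
      rw [apps_snoc, apps_snoc]
      intro h
      exact ih _ (PreTerm.app.inj h).1

theorem hasType_unique {T : Type u} {G : Type v} {W : Type w} {symTy : G → Ty T} {varTy : W → Ty T}
    {t : PreTerm G W} {A B : Ty T} (h : HasType symTy varTy t A) (h' : HasType symTy varTy t B) :
    A = B := by
  induction h generalizing B with
  | sym f => cases h'; rfl
  | var y => cases h'; rfl
  | app _ _ ih _ =>
    cases h' with
    | app h₀ _ => exact (Ty.arrow.inj (ih h₀)).2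

theorem hasTy_apps (R : LCSTRS.{u, v, w, x} S F V) {t : PreTerm F V} {A : Ty S}
    (ht : R.HasTy t A) {ts : List (PreTerm F V)} {b : S} (h : R.HasTy (apps t ts) (.base b)) :
    A.target = b ∧ List.Forall₂ R.HasTy ts A.argTys := by
  induction ts generalizing t A with
  | nil =>
    cases hasType_unique ht h
    exact ⟨rfl, .nil⟩
  | cons u ts ih =>
    have key : ∀ (ts : List (PreTerm F V)) (r : PreTerm F V) (B : Ty S),
        R.HasTy (apps r ts) B → ∃ C, R.HasTy r C := by
      intro ts
      induction ts with
      | nil => intro r B h; exact ⟨B, h⟩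
      | cons u ts ih =>
        intro r B h
        obtain ⟨C, hC⟩ := ih (app r u) B h
        cases hC with
        | app h₀ _ => exact ⟨_, h₀⟩
    obtain ⟨C, hC⟩ := key ts (app t u) _ h
    cases hC with
    | app h₀ h₁ =>
      cases hasType_unique ht h₀
      obtain ⟨e, l⟩ := ih (HasType.app h₀ h₁) h
      exact ⟨e, .cons h₁ l⟩

theorem hasTy_of_eval (R : LCSTRS.{u, v, w, x} S F V) {t : PreTerm F V} {A : Ty S}
    {a : A.denote R.Dom} (h : R.Eval t A a) : R.HasTy t A := by
  induction h with
  | sym f _ => exact .sym f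
  | app _ _ h₀ h₁ => exact .app h₀ h₁

theorem hasTy_subst (R : LCSTRS.{u, v, w, x} S F V) {σ : V → PreTerm F V} (hσ : R.IsSubst σ)
    {t : PreTerm F V} {A : Ty S} (h : R.HasTy t A) : R.HasTy (t.subst σ) A := by
  induction h with
  | sym f => exact .sym f
  | var y => exact hσ y
  | app _ _ h₀ h₁ => exact .app h₀ h₁

theorem hasTy_of_rew (R : LCSTRS.{u, v, w, x} S F V) {t t' : PreTerm F V} (h : R.Rew t t')
    {A : Ty S} (ht : R.HasTy t A) : R.HasTy t' A := by
  obtain ⟨C, a, b, hab, rfl, rfl⟩ := h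
  induction C generalizing A with
  | hole =>
    change R.HasTy a A at ht
    change R.HasTy b A
    rcases hab with ⟨ρ, hρ, σ, hσ, -, rfl, rfl⟩ | ⟨f, -, vs, -, -, -, -, s, c, h₁, h₂⟩
    · obtain ⟨B, h₁, h₂⟩ := (R.isRule ρ hρ).same_type
      cases hasType_unique ht (R.hasTy_subst hσ h₁)
      exact R.hasTy_subst hσ h₂
    · cases hasType_unique ht (R.hasTy_of_eval h₁)
      exact R.hasTy_of_eval h₂
  | appL C u ih =>
    cases ht with
    | app h₀ h₁ => exact .app (ih h₀) h₁
  | appR u C ih =>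
    cases ht with
    | app h₀ h₁ => exact .app h₀ (ih h₁)

theorem hasTy_of_compAt (R : LCSTRS.{u, v, w, x} S F V) {I : S → Set (PreTerm F V)} {A : Ty S}
    {t : PreTerm F V} (h : R.CompAt I A t) : R.HasTy t A := by
  cases A <;> exact h.1

theorem gt_trans_ge (o : SortOrdering S) {a b c : S} (h : o.ge a b) (h' : o.gt b c) : o.gt a c :=
  ⟨o.trans _ _ _ h h'.1, fun k => h'.2 (o.trans _ _ _ k h)⟩

theorem ge_trans_pos_neg (o : SortOrdering S) {a b : S} (h : o.ge a b) (A : Ty S) :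
    (o.posGe b A → o.posGe a A) ∧ (o.negGt b A → o.negGt a A) := by
  induction A with
  | base c => exact ⟨fun k => o.trans _ _ _ h k, fun k => gt_trans_ge o h k⟩
  | arrow A B ihA ihB =>
    exact ⟨fun k => ⟨ihA.2 k.1, ihB.1 k.2⟩, fun k => ⟨ihA.1 k.1, ihB.2 k.2⟩⟩

theorem posGe_target (o : SortOrdering S) {a : S} {A : Ty S} (h : o.posGe a A) :
    o.ge a A.target ∧ ∀ B ∈ A.argTys, o.negGt a B := by
  induction A with
  | base c => exact ⟨h, by simp [Ty.argTys]⟩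
  | arrow A B _ ihB =>
    refine ⟨(ihB h.2).1, ?_⟩
    intro C hC
    rcases List.mem_cons.1 hC with rfl | hC
    · exact h.1
    · exact (ihB h.2).2 C hC

/-- `I` is contained in `I'` at the sorts `c` with `a ≿ c`, and they agree where `a ≻ c`. -/
def FamLe (o : SortOrdering S) (a : S) (I I' : S → Set (PreTerm F V)) : Prop :=
  (∀ c, o.ge a c → I c ⊆ I' c) ∧ ∀ c, o.gt a c → I' c ⊆ I c

theorem compAt_mono (R : LCSTRS.{u, v, w, x} S F V) {o : SortOrdering S} {a : S}
    {I I' : S → Set (PreTerm F V)} (H : FamLe o a I I') (A : Ty S) :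
    (o.posGe a A → ∀ t, R.CompAt I A t → R.CompAt I' A t) ∧
    (o.negGt a A → ∀ t, R.CompAt I' A t → R.CompAt I A t) := by
  induction A with
  | base c => exact ⟨fun k t h => ⟨h.1, H.1 c k h.2⟩, fun k t h => ⟨h.1, H.2 c k h.2⟩⟩
  | arrow A B ihA ihB =>
    exact ⟨fun k t h => ⟨h.1, fun r hr => ihB.1 k.2 _ (h.2 r (ihA.2 k.1 r hr))⟩,
      fun k t h => ⟨h.1, fun r hr => ihB.2 k.2 _ (h.2 r (ihA.1 k.1 r hr))⟩⟩

theorem forall₂_get {α : Type u} {β : Type v} {r : α → β → Prop} {l : List α} {m : List β}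
    (h : List.Forall₂ r l m) {k : ℕ} {a : α} {b : β} (ha : l[k]? = some a) (hb : m[k]? = some b) :
    r a b := by
  induction h generalizing k with
  | nil => simp at ha
  | cons h₀ _ ih =>
    cases k with
    | zero => simp at ha hb; exact ha ▸ hb ▸ h₀
    | succ k => exact ih (by simpa using ha) (by simpa using hb)

theorem forall₂_mem {α : Type u} {β : Type v} {r : α → β → Prop} {l : List α} {m : List β}
    (h : List.Forall₂ r l m) {a : α} (ha : a ∈ l) : ∃ b ∈ m, r a b := by
  induction h with
  | nil => simp at ha
  | cons h₀ _ ih =>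
    rcases List.mem_cons.1 ha with rfl | ha
    · exact ⟨_, List.mem_cons_self, h₀⟩
    · obtain ⟨b, hb, h⟩ := ih ha
      exact ⟨b, List.mem_cons_of_mem _ hb, h⟩

theorem accStep_anti (R : LCSTRS.{u, v, w, x} S F V) {o : SortOrdering S} {a : S}
    {I I' : S → Set (PreTerm F V)} (H : FamLe o a I I') {s t : PreTerm F V} {c : S}
    (hc : o.ge a c) (hs : R.HasTy s (.base c)) (h : R.AccStep o I' s t) :
    R.AccStep o I s t ∧ ∃ d, o.ge a d ∧ R.HasTy t (.base d) := by
  obtain ⟨h₁, ⟨d, hd⟩, f, ss, k, sk, ts, rfl, ⟨A, hA, hpos⟩, hk, rfl, hts⟩ := h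
  obtain ⟨e, l⟩ := R.hasTy_apps (.sym f) hs
  rw [e] at hpos
  have hsk := forall₂_get l hk hA
  obtain ⟨e', l'⟩ := R.hasTy_apps hsk hd
  have hpos' := (ge_trans_pos_neg o hc A).1 hpos
  obtain ⟨hge, hneg⟩ := posGe_target o hpos'
  refine ⟨⟨h₁, ⟨d, hd⟩, f, ss, k, sk, ts, rfl, ⟨A, hA, e ▸ hpos⟩, hk, rfl, ?_⟩, d, e' ▸ hge, hd⟩
  intro ti hti
  obtain ⟨B, hB, hB'⟩ := forall₂_mem l' hti
  obtain ⟨B', hc'⟩ := hts ti hti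
  cases hasType_unique hB' (R.hasTy_of_compAt hc')
  exact ⟨B, (R.compAt_mono H B).2 (hneg B hB) ti hc'⟩

theorem candStep_mono (R : LCSTRS.{u, v, w, x} S F V) {o : SortOrdering S} {a : S}
    {I I' : S → Set (PreTerm F V)} (H : FamLe o a I I') {b : S} (hb : o.ge a b) :
    R.candStep o I b ⊆ R.candStep o I' b := by
  rintro t ⟨ht, hacc, h⟩
  refine ⟨ht, ?_, ?_⟩
  · clear h
    unfold Terminating at hacc ⊢
    induction hacc generalizing b with
    | intro t _ ih =>
      refine ⟨t, fun t' h' => ?_⟩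
      rcases h' with h' | h'
      · exact ih t' (.inl h') hb (R.hasTy_of_rew h' ht)
      · obtain ⟨h'', d, hd, hd'⟩ := R.accStep_anti H hb ht h'
        exact ih t' (.inr h'') hd hd'
  · intro f ts hr i ti hi hacc'
    have hty : ∀ t', Relation.ReflTransGen R.Rew t t' → R.HasTy t' (.base b) := by
      intro t' hr
      induction hr with
      | refl => exact ht
      | tail _ h ih => exact R.hasTy_of_rew h ih
    obtain ⟨e, l⟩ := R.hasTy_apps (.sym f) (hty _ hr)
    obtain ⟨B, hB⟩ := h f ts hr i ti hi hacc'
    obtain ⟨A, hA, hpos⟩ := hacc'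
    cases hasType_unique (forall₂_get l hi hA) (R.hasTy_of_compAt hB)
    rw [e] at hpos
    exact ⟨B, (R.compAt_mono H B).1 ((ge_trans_pos_neg o hb B).1 hpos) ti hB⟩

theorem mem_candSet_def (R : LCSTRS.{u, v, w, x} S F V) (o : SortOrdering S) (a : S)
    (t : PreTerm F V) : t ∈ R.candSet o a ↔ ∀ I : S → Set (PreTerm F V),
      (∀ b, o.ge a b → o.ge b a → R.candStep o (glue o a (fun b _ => R.candSet o b) I) b ⊆ I b) →
      t ∈ I a := by
  unfold candSet
  rw [WellFounded.fix_eq]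
  rfl

theorem glue_below (o : SortOrdering S) (a : S) (K I : S → Set (PreTerm F V)) {b : S}
    (h : o.gt a b) : glue o a (fun b _ => K b) I b = K b := dif_pos h

theorem glue_equiv (o : SortOrdering S) (a : S) (K I : S → Set (PreTerm F V)) {b : S}
    (h : o.ge a b) (h' : o.ge b a) : glue o a (fun b _ => K b) I b = I b := by
  unfold glue
  rw [dif_neg fun k => k.2 h', if_pos ⟨h, h'⟩]

theorem glue_congr (o : SortOrdering S) {a a' : S} (h : o.ge a a') (h' : o.ge a' a)
    (K I : S → Set (PreTerm F V)) :
    glue o a (fun b _ => K b) I = glue o a' (fun b _ => K b) I := by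
  funext b
  have e : o.ge a b ↔ o.ge a' b := ⟨o.trans _ _ _ h', o.trans _ _ _ h⟩
  have e' : o.ge b a ↔ o.ge b a' := ⟨fun k => o.trans _ _ _ k h, fun k => o.trans _ _ _ k h'⟩
  by_cases k : o.ge a b <;> by_cases k' : o.ge b a <;>
    simp [glue, k, k', e.symm, e'.symm]

theorem glue_famLe (o : SortOrdering S) (a : S) (K I I' : S → Set (PreTerm F V))
    (h : ∀ b, o.ge a b → o.ge b a → I b ⊆ I' b) :
    FamLe o a (glue o a (fun b _ => K b) I) (glue o a (fun b _ => K b) I') := by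
  refine ⟨fun c hc => ?_, fun c hc => ?_⟩
  · by_cases hc' : o.ge c a
    · rw [glue_equiv o a K I hc hc', glue_equiv o a K I' hc hc']
      exact h c hc hc'
    · rw [glue_below o a K I ⟨hc, hc'⟩, glue_below o a K I' ⟨hc, hc'⟩]
  · rw [glue_below o a K I hc, glue_below o a K I' hc]

/-- `t ∈ ℂ_a` if and only if `t : a` is terminating with respect to `→ ∪ ⇛_ℂ` and the accessible
arguments of all its reducts `f t₁ ⋯ tₙ` are `ℂ`-computable. -/
theorem mem_candSet_iff (R : LCSTRS.{u, v, w, x} S F V) (o : SortOrdering S) (a : S)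
    (t : PreTerm F V) : t ∈ R.candSet o a ↔ t ∈ R.candStep o (R.candSet o) a := by
  have hsub : ∀ b, o.ge a b → o.ge b a →
      R.candStep o (glue o a (fun b _ => R.candSet o b) (R.candSet o)) b ⊆ R.candSet o b := by
    intro b hab hba t ht
    rw [mem_candSet_def]
    intro I hI
    rw [← glue_congr o hab hba] at hI
    refine hI b (o.refl b) (o.refl b) (R.candStep_mono (glue_famLe o a _ _ _ ?_) hab ht)
    intro c hac hca r hr
    rw [mem_candSet_def] at hr
    refine hr I fun d hcd hdc => ?_
    rw [← glue_congr o hac hca]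
    exact hI d (o.trans _ _ _ hba (o.trans _ _ _ hac hcd))
      (o.trans _ _ _ hdc (o.trans _ _ _ hca hab))
  have heq : ∀ c, o.ge a c →
      glue o a (fun b _ => R.candSet o b) (R.candSet o) c = R.candSet o c := by
    intro c hc
    by_cases hc' : o.ge c a
    · exact glue_equiv o a _ _ hc hc'
    · exact glue_below o a _ _ ⟨hc, hc'⟩
  constructor
  · intro ht
    rw [mem_candSet_def] at ht
    have := ht (R.candStep o (glue o a (fun b _ => R.candSet o b) (R.candSet o)))
      fun b hab hba => R.candStep_mono (glue_famLe o a _ _ _ hsub) hab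
    exact R.candStep_mono ⟨fun c hc => (heq c hc).le, fun c hc => (heq c hc.1).ge⟩ (o.refl a) this
  · intro ht
    exact hsub a (o.refl a) (o.refl a)
      (R.candStep_mono ⟨fun c hc => (heq c hc).ge, fun c hc => (heq c hc.1).le⟩ (o.refl a) ht)

/-- `ℂ` is an RC-set. -/
theorem candSet_isRCSet (R : LCSTRS.{u, v, w, x} S F V) (o : SortOrdering S) :
    R.IsRCSet (R.candSet o) where
  terminating a t ht := by
    obtain ⟨h, h', -⟩ := (R.mem_candSet_iff o a t).1 ht
    exact ⟨h, Subrelation.accessible (fun k => Or.inl k) h'⟩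
  closed a s hs t hst := by
    obtain ⟨h, h', h''⟩ := (R.mem_candSet_iff o a s).1 hs
    exact (R.mem_candSet_iff o a t).2 ⟨R.hasTy_of_rew hst h, h'.inv (.inl hst),
      fun f ts hr => h'' f ts (.head hst hr)⟩
  neutral a s hs hn H := by
    obtain ⟨y, us, rfl⟩ := hn
    refine (R.mem_candSet_iff o a _).2 ⟨hs, ⟨_, fun t ht => ?_⟩, fun f ts hr => ?_⟩
    · rcases ht with ht | ⟨-, -, f, ss, k, sk, ts, h, -⟩
      · exact ((R.mem_candSet_iff o a t).1 (H t ht)).2.1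
      · exact absurd h (apps_var_ne_apps_sym y f us ss)
    · rcases Relation.ReflTransGen.cases_head hr with h | ⟨t, hst, hr'⟩
      · exact absurd h (apps_var_ne_apps_sym y f us ts)
      · exact ((R.mem_candSet_iff o a t).1 (H t hst)).2.2 f ts hr'

/-! ## Marked symbols and static dependency pairs -/

/-- The marked symbols: one for each defined symbol. -/
abbrev DSym (R : LCSTRS.{u, v, w, x} S F V) : Type v := {f : F // R.Defined f}

/-- The extended set of function symbols: `F` together with the marked symbols. -/
abbrev SharpSym (R : LCSTRS.{u, v, w, x} S F V) : Type v := F ⊕ R.DSym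

/-- The types of the symbols in the extended set. -/
def sharpSymTy (R : LCSTRS.{u, v, w, x} S F V) : R.SharpSym → Ty (Option S)
  | .inl f => (R.symTy f).lift
  | .inr f => (R.symTy f.1).sharp

/-- `t : A` for pre-terms over the extended set of function symbols. -/
abbrev SharpHasTy (R : LCSTRS.{u, v, w, x} S F V) (t : PreTerm R.SharpSym V) (A : Ty (Option S)) :
    Prop :=
  HasType R.sharpSymTy (fun y => (R.varTy y).lift) t A

/-- Terms over the extended set of function symbols. -/
abbrev SharpTerm (R : LCSTRS.{u, v, w, x} S F V) : Type (max v w) :=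
  {t : PreTerm R.SharpSym V // ∃ A, R.SharpHasTy t A}

/-- A term without marked symbols, seen as a term over the extended set of function symbols. -/
def emb (R : LCSTRS.{u, v, w, x} S F V) (t : PreTerm F V) : PreTerm R.SharpSym V :=
  t.mapSym Sum.inl

/-- `t σ` for `t` over the extended set of function symbols. A substitution takes its values in
terms without marked symbols: such symbols cannot occur in a term whose type does not
mention `dp`, because no symbol and no variable has an argument type that mentions `dp`. -/
def sharpSubst (R : LCSTRS.{u, v, w, x} S F V) (σ : V → PreTerm F V) (t : PreTerm R.SharpSym V) :
    PreTerm R.SharpSym V :=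
  t.subst fun y => R.emb (σ y)

/-- The rewrite relation of `R` on terms over the extended set of function symbols. -/
def SharpRew (R : LCSTRS.{u, v, w, x} S F V) :
    PreTerm R.SharpSym V → PreTerm R.SharpSym V → Prop :=
  CtxClosure fun t t' => ∃ a b, (R.RuleStep a b ∨ R.CalcStep a b) ∧ t = R.emb a ∧ t' = R.emb b

/-- The calculation steps `→_κ` on terms over the extended set of function symbols. -/
def SharpCalc (R : LCSTRS.{u, v, w, x} S F V) :
    PreTerm R.SharpSym V → PreTerm R.SharpSym V → Prop :=
  CtxClosure fun t t' => ∃ a b, R.CalcStep a b ∧ t = R.emb a ∧ t' = R.emb b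

/-- `t'` is the `κ`-normal form of `t`. -/
def IsCalcNF (R : LCSTRS.{u, v, w, x} S F V) (t t' : PreTerm R.SharpSym V) : Prop :=
  Relation.ReflTransGen R.SharpCalc t t' ∧ ∀ t'', ¬ R.SharpCalc t' t''

/-- The number of arguments of `f`, and of the marked symbol for `f`. -/
def arity (R : LCSTRS.{u, v, w, x} S F V) (f : F) : ℕ := (R.symTy f).argTys.length

/-- The type of the `i`-th argument of `f`, and of the marked symbol for `f`. -/
def argTy (R : LCSTRS.{u, v, w, x} S F V) (f : F) (i : Fin (R.arity f)) : Ty S :=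
  (R.symTy f).argTys.get i

/-- Terms of type `dp`. As no symbol and no variable has an argument type that mentions `dp`, and
no variable has a type that mentions it, these are the terms `f♯ t₁ ⋯ tₙ` with `f♯` a marked symbol
applied to all its arguments, which are terms without marked symbols. -/
structure DPTerm (R : LCSTRS.{u, v, w, x} S F V) where
  head : R.DSym
  args : Fin (R.arity head) → PreTerm F V
  typed : ∀ i, R.HasTy (args i) (R.argTy head i)

/-- The term `f♯ t₁ ⋯ tₙ`. -/
def DPTerm.toTerm {R : LCSTRS.{u, v, w, x} S F V} (t : R.DPTerm) : PreTerm R.SharpSym V :=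
  apps (sym (.inr t.head)) (List.ofFn fun i => R.emb (t.args i))

/-- The unmarked term `f t₁ ⋯ tₙ`. -/
def DPTerm.unmark {R : LCSTRS.{u, v, w, x} S F V} (t : R.DPTerm) : PreTerm F V :=
  apps (sym t.head.1) (List.ofFn t.args)

/-- Static dependency pairs `s♯ ⇒ t♯ [φ | L]`. -/
structure SDP (R : LCSTRS.{u, v, w, x} S F V) where
  lhs : R.DPTerm
  rhs : R.DPTerm
  cond : PreTerm F V
  isConstraint : R.IsConstraint cond
  L : Set V
  theoryVars : ∀ y ∈ L, R.IsTheoryVar y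
  vars_subset : cond.vars ⊆ L

/-- A substitution that instantiates the variables in `L` to ground theory terms and makes `φ`
true. -/
def RespectsOn (R : LCSTRS.{u, v, w, x} S F V) (φ : PreTerm F V) (L : Set V)
    (σ : V → PreTerm F V) : Prop :=
  R.IsSubst σ ∧ (∀ y ∈ L, R.IsGroundTheoryTerm (σ y)) ∧ R.IsTrue (φ.subst σ)

/-- `(𝒫, R)`-chains of length `n`, finite or infinite; only the first `n` elements of the sequence
matter. -/
def IsChain (R : LCSTRS.{u, v, w, x} S F V) (P : Set R.SDP) (n : ℕ∞)
    (c : ℕ → R.SDP × (V → PreTerm F V)) : Prop :=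
  (∀ i : ℕ, (i : ℕ∞) < n → (c i).1 ∈ P ∧ R.RespectsOn (c i).1.cond (c i).1.L (c i).2) ∧
  ∀ i : ℕ, ((i + 1 : ℕ) : ℕ∞) < n →
    Relation.ReflTransGen R.SharpRew (R.sharpSubst (c i).2 (c i).1.rhs.toTerm)
      (R.sharpSubst (c (i + 1)).2 (c (i + 1)).1.lhs.toTerm)

/-- The chain (of length `n`) is computable. -/
def IsComputableChain (R : LCSTRS.{u, v, w, x} S F V) (o : SortOrdering S) (n : ℕ∞)
    (c : ℕ → R.SDP × (V → PreTerm F V)) : Prop :=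
  ∀ i : ℕ, (i : ℕ∞) < n → ∀ t, ProperSubterm (c i).1.rhs.unmark t →
    R.Comp (R.candSet o) (t.subst (c i).2)

/-! ## DP problems and processors -/

/-- The DP problem is finite: there is no infinite computable chain. -/
def IsFinite (R : LCSTRS.{u, v, w, x} S F V) (o : SortOrdering S) (P : Set R.SDP) : Prop :=
  ¬ ∃ c, R.IsChain P ⊤ c ∧ R.IsComputableChain o ⊤ c

/-- DP processors: partial mappings from DP problems to sets of DP problems. -/
abbrev Processor (R : LCSTRS.{u, v, w, x} S F V) : Type _ := Set R.SDP → Option (Set (Set R.SDP))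

/-- Soundness of a DP processor. -/
def Sound (R : LCSTRS.{u, v, w, x} S F V) (o : SortOrdering S) (ρ : R.Processor) : Prop :=
  ∀ P Q, ρ P = some Q → (∀ P' ∈ Q, R.IsFinite o P') → R.IsFinite o P

/-- The (defined symbols whose marked versions are) heads of either side of a pair in `P`. -/
def heads (R : LCSTRS.{u, v, w, x} S F V) (P : Set R.SDP) : Set R.DSym :=
  {f | ∃ p ∈ P, f = p.lhs.head ∨ f = p.rhs.head}

theorem lhs_head_mem (R : LCSTRS.{u, v, w, x} S F V) {P : Set R.SDP} {p : R.SDP} (hp : p ∈ P) :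
    p.lhs.head ∈ R.heads P := ⟨p, hp, .inl rfl⟩

theorem rhs_head_mem (R : LCSTRS.{u, v, w, x} S F V) {P : Set R.SDP} {p : R.SDP} (hp : p ∈ P) :
    p.rhs.head ∈ R.heads P := ⟨p, hp, .inr rfl⟩

/-! ### Graph processors -/

/-- The directed graph with edge relation `E` and the mapping `θ` form a graph approximation. -/
def IsGraphApprox (R : LCSTRS.{u, v, w, x} S F V) (P : Set R.SDP) {N : Type} (E : N → N → Prop)
    (θ : P → N) : Prop :=
  Finite N ∧ ∀ p₀ p₁ : P, (∃ c, R.IsChain P 2 c ∧ (c 0).1 = p₀ ∧ (c 1).1 = p₁) → E (θ p₀) (θ p₁)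

/-- `C` is a strongly connected component of the directed graph with edge relation `E`. -/
def IsSCC {N : Type} (E : N → N → Prop) (C : Set N) : Prop :=
  ∃ a, C = {b | Relation.ReflTransGen E a b ∧ Relation.ReflTransGen E b a}

/-- `C` is non-trivial: it contains an edge (that is, it is not a single vertex without a loop). -/
def IsNontrivialSCC {N : Type} (E : N → N → Prop) (C : Set N) : Prop :=
  IsSCC E C ∧ ∃ a ∈ C, ∃ b ∈ C, E a b

/-- Graph processors. -/
def IsGraphProcessor (R : LCSTRS.{u, v, w, x} S F V) (ρ : R.Processor) : Prop :=
  ∀ P Q, ρ P = some Q → ∃ (N : Type) (E : N → N → Prop) (θ : P → N), R.IsGraphApprox P E θ ∧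
    Q = {P' | ∃ C, IsNontrivialSCC E C ∧ P' = {p | ∃ h : p ∈ P, θ ⟨p, h⟩ ∈ C}}

/-! ### Subterm criterion processors -/

/-- Projections; argument positions are counted from 0. -/
abbrev Projection (R : LCSTRS.{u, v, w, x} S F V) (P : Set R.SDP) : Type _ :=
  (f : R.DSym) → f ∈ R.heads P → Fin (R.arity f)

/-- The projection `ν` `▷`-orients `P'`. -/
def SubtermOrients (R : LCSTRS.{u, v, w, x} S F V) (P P' : Set R.SDP) (ν : R.Projection P) :
    Prop :=
  ∀ p, ∀ hp : p ∈ P,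
    let l := p.lhs.args (ν p.lhs.head (R.lhs_head_mem hp))
    let r := p.rhs.args (ν p.rhs.head (R.rhs_head_mem hp))
    (p ∈ P' → ProperSubterm l r) ∧ (p ∉ P' → l = r)

/-- Subterm criterion processors. -/
def IsSubtermProcessor (R : LCSTRS.{u, v, w, x} S F V) (ρ : R.Processor) : Prop :=
  ∀ P Q, ρ P = some Q → ∃ P' ⊆ P, P'.Nonempty ∧ (∃ ν, R.SubtermOrients P P' ν) ∧ Q = {P \ P'}

/-! ### Integer mapping processors -/

/-- The sort of integers and the symbols `≥`, `>` and `∧` with their standard interpretation; `zero`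
is the value that denotes `0`. -/
structure IntTheory (R : LCSTRS.{u, v, w, x} S F V) where
  int : S
  int_mem : int ∈ R.theorySorts
  intEquiv : R.Dom int ≃ ℤ
  zero : F
  geSym : F
  gtSym : F
  andSym : F
  zero_eval : R.Eval (sym zero) (.base int) (intEquiv.symm 0)
  ge_eval : R.Eval (sym geSym) (.arrow (.base int) (.arrow (.base int) (.base R.bool)))
    fun a b => R.boolEquiv.symm (decide (intEquiv a ≥ intEquiv b))
  gt_eval : R.Eval (sym gtSym) (.arrow (.base int) (.arrow (.base int) (.base R.bool)))
    fun a b => R.boolEquiv.symm (decide (intEquiv a > intEquiv b))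
  and_eval : R.Eval (sym andSym) (.arrow (.base R.bool) (.arrow (.base R.bool) (.base R.bool)))
    fun a b => R.boolEquiv.symm (R.boolEquiv a && R.boolEquiv b)

/-- The term `s ≥ t`. -/
def IntTheory.ge {R : LCSTRS.{u, v, w, x} S F V} (Z : R.IntTheory) (s t : PreTerm F V) :
    PreTerm F V := apps (sym Z.geSym) [s, t]

/-- The term `s > t`. -/
def IntTheory.gt {R : LCSTRS.{u, v, w, x} S F V} (Z : R.IntTheory) (s t : PreTerm F V) :
    PreTerm F V := apps (sym Z.gtSym) [s, t]

/-- The term `s ∧ t`. -/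
def IntTheory.and {R : LCSTRS.{u, v, w, x} S F V} (Z : R.IntTheory) (s t : PreTerm F V) :
    PreTerm F V := apps (sym Z.andSym) [s, t]

/-- The argument positions `i` of `f♯` whose type is a theory sort and such that the `i`-th argument
of any occurrence of `f♯` in a pair `s♯ ⇒ t♯ [φ | L]` is a theory term with variables in `L`. -/
def theoryPos (R : LCSTRS.{u, v, w, x} S F V) (P : Set R.SDP) (f : R.DSym) :
    Set (Fin (R.arity f)) :=
  {i | (R.argTy f i).IsTheorySort R.theorySorts ∧
    ∀ p ∈ P, ∀ t : R.DPTerm, t = p.lhs ∨ t = p.rhs → ∀ h : t.head = f,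
      R.IsTheoryTerm (t.args (h ▸ i)) ∧ (t.args (h ▸ i)).vars ⊆ p.L}

/-- Integer mappings. The fresh variable for the `i`-th argument of `f♯` is represented by the
position `i` itself. -/
def IsIntMapping (R : LCSTRS.{u, v, w, x} S F V) (Z : R.IntTheory) (P : Set R.SDP)
    (J : (f : R.DSym) → PreTerm F (Fin (R.arity f))) : Prop :=
  ∀ f ∈ R.heads P, HasType R.symTy (R.argTy f) (J f) (.base Z.int) ∧
    (J f).syms ⊆ R.theorySyms ∧ (J f).vars ⊆ R.theoryPos P f

/-- The extension of an integer mapping to terms `f♯ t₁ ⋯ tₙ`. -/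
def intVal (R : LCSTRS.{u, v, w, x} S F V) (J : (f : R.DSym) → PreTerm F (Fin (R.arity f)))
    (t : R.DPTerm) : PreTerm F V :=
  (J t.head).subst t.args

/-- The integer mapping `J` `>`-orients `P'`. -/
def IntOrients (R : LCSTRS.{u, v, w, x} S F V) (Z : R.IntTheory) (P P' : Set R.SDP)
    (J : (f : R.DSym) → PreTerm F (Fin (R.arity f))) : Prop :=
  ∀ p ∈ P,
    (p ∈ P' → R.Entails p.cond
      (Z.and (Z.ge (R.intVal J p.lhs) (sym Z.zero)) (Z.gt (R.intVal J p.lhs) (R.intVal J p.rhs)))) ∧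
    (p ∉ P' → R.Entails p.cond (Z.ge (R.intVal J p.lhs) (R.intVal J p.rhs)))

/-- Integer mapping processors. -/
def IsIntProcessor (R : LCSTRS.{u, v, w, x} S F V) (Z : R.IntTheory) (ρ : R.Processor) : Prop :=
  ∀ P Q, ρ P = some Q → ∃ P' ⊆ P, P'.Nonempty ∧
    (∃ J, R.IsIntMapping Z P J ∧ R.IntOrients Z P P' J) ∧ Q = {P \ P'}

/-! ### Theory argument processors -/

/-- The variables of the arguments of `t = f♯ t₁ ⋯ tₙ` at the positions in `τ(f♯)`. -/
def theoryArgVars (R : LCSTRS.{u, v, w, x} S F V) (τ : (f : R.DSym) → Set (Fin (R.arity f)))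
    (t : R.DPTerm) : Set V :=
  ⋃ i ∈ τ t.head, (t.args i).vars

/-- Theory argument mappings (values outside `heads P` are irrelevant). -/
def IsTheoryArgMapping (R : LCSTRS.{u, v, w, x} S F V) (P : Set R.SDP)
    (τ : (f : R.DSym) → Set (Fin (R.arity f))) : Prop :=
  (∀ f ∈ R.heads P, ∀ i ∈ τ f, (R.argTy f i).IsTheorySort R.theorySorts) ∧
  (∀ p ∈ P, ∀ i ∈ τ p.lhs.head, R.IsTheoryTerm (p.lhs.args i) ∧
    ∀ y ∈ (p.lhs.args i).vars, R.IsTheoryVar y) ∧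
  ∀ p ∈ P, ∀ j ∈ τ p.rhs.head, R.IsTheoryTerm (p.rhs.args j) ∧
    (p.rhs.args j).vars ⊆ p.L ∪ R.theoryArgVars τ p.lhs

/-- `q` is obtained from `p` by adding the variables of the theory arguments of its left-hand side
to the component `L`. -/
def IsTheoryArgExt (R : LCSTRS.{u, v, w, x} S F V) (τ : (f : R.DSym) → Set (Fin (R.arity f)))
    (p q : R.SDP) : Prop :=
  q.lhs = p.lhs ∧ q.rhs = p.rhs ∧ q.cond = p.cond ∧ q.L = p.L ∪ R.theoryArgVars τ p.lhs

/-- The theory argument mapping `τ` fixes `P'`. -/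
def TheoryArgFixes (R : LCSTRS.{u, v, w, x} S F V) (P' : Set R.SDP)
    (τ : (f : R.DSym) → Set (Fin (R.arity f))) : Prop :=
  ∀ p ∈ P', R.theoryArgVars τ p.rhs ⊆ p.L

/-- Theory argument processors. -/
def IsTheoryArgProcessor (R : LCSTRS.{u, v, w, x} S F V) (ρ : R.Processor) : Prop :=
  ∀ P Q, ρ P = some Q → ∃ P' ⊆ P, P'.Nonempty ∧
    ∃ τ, R.IsTheoryArgMapping P τ ∧ R.TheoryArgFixes P' τ ∧
      Q = {{q | ∃ p ∈ P, R.IsTheoryArgExt τ p q}, P \ P'}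

/-! ### Reduction pair processors -/

/-- Constrained relations. -/
structure ConstrainedRel (R : LCSTRS.{u, v, w, x} S F V) where
  rel : PreTerm R.SharpSym V → PreTerm R.SharpSym V → PreTerm F V → Set V → Prop
  same_type : ∀ s t φ L, rel s t φ L → ∃ A, R.SharpHasTy s A ∧ R.SharpHasTy t A
  isConstraint : ∀ s t φ L, rel s t φ L → R.IsConstraint φ
  theoryVars : ∀ s t φ L, rel s t φ L → ∀ y ∈ L, R.IsTheoryVar y
  vars_subset : ∀ s t φ L, rel s t φ L → φ.vars ⊆ L

/-- The binary relation `r` over terms covers the constrained relation `K`. -/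
def Covers (R : LCSTRS.{u, v, w, x} S F V) (r : R.SharpTerm → R.SharpTerm → Prop)
    (K : R.ConstrainedRel) : Prop :=
  ∀ s t φ L, K.rel s t φ L → ∀ σ, R.RespectsOn φ L σ → ∀ s' t' : R.SharpTerm,
    R.IsCalcNF (R.sharpSubst σ s) s' → R.IsCalcNF (R.sharpSubst σ t) t' → r s' t'

/-- Monotonicity: `s ⊒ t` implies `C[s] ⊒ C[t]`, for `s` and `t` of the type of the hole. -/
def Monotonic (R : LCSTRS.{u, v, w, x} S F V) (r : R.SharpTerm → R.SharpTerm → Prop) : Prop :=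
  ∀ (C : Ctx R.SharpSym V) (s t s' t' : R.SharpTerm) (A : Ty (Option S)),
    R.SharpHasTy s A → R.SharpHasTy t A → (s' : PreTerm R.SharpSym V) = C.fill s →
    (t' : PreTerm R.SharpSym V) = C.fill t → r s t → r s' t'

/-- `(⪰, ≻)` is a constrained reduction pair. -/
def IsReductionPair (R : LCSTRS.{u, v, w, x} S F V) (geq gt : R.ConstrainedRel) : Prop :=
  ∃ sq sqs : R.SharpTerm → R.SharpTerm → Prop,
    R.Covers sq geq ∧ (∀ s, sq s s) ∧ (∀ s t : R.SharpTerm, R.SharpCalc s t → sq s t) ∧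
    R.Monotonic sq ∧
    R.Covers sqs gt ∧ WellFounded (fun s t => sqs t s) ∧
    ∀ s t r, sq s t → sqs t r → Relation.TransGen sqs s r

/-- Constrained reduction pair processors. -/
def IsReductionPairProcessor (R : LCSTRS.{u, v, w, x} S F V) (ρ : R.Processor) : Prop :=
  ∀ P Q, ρ P = some Q → ∃ P' ⊆ P, P'.Nonempty ∧
    (∃ geq gt : R.ConstrainedRel, R.IsReductionPair geq gt ∧
      (∀ p ∈ P', gt.rel p.lhs.toTerm p.rhs.toTerm p.cond p.L) ∧
      (∀ p ∈ P \ P', geq.rel p.lhs.toTerm p.rhs.toTerm p.cond p.L) ∧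
      ∀ r ∈ R.rules, geq.rel (R.emb r.lhs) (R.emb r.rhs) r.cond
        (r.cond.vars ∪ (r.rhs.vars \ r.lhs.vars))) ∧
    Q = {P \ P'}

end LCSTRS

/-! ## Terms and substitutions -/

-- Soundness is proved by following an infinite computable chain for `P`. Two facts serve all five
-- classes. Marked symbols occur in no redex, so the reduction between consecutive pairs takes place
-- inside the arguments of a fixed marked head (`rews_args`). And every tail of an infinite
-- computable chain is again one; hence if `P \ P'` is finite, pairs of `P'` occur in the chain
-- arbitrarily late (`IsFinite.exists_mem`).
--
-- Graph processors: the chain traces an infinite path in a finite graph. Some vertex recurs, and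
-- from its first visit on the path stays in the strongly connected component of that vertex.
--
-- Subterm criterion: the projected arguments form an infinite sequence of rewrite and subterm
-- steps, with a proper subterm step at each pair of `P'`. The sequence passes through a computable
-- term. Computable terms terminate (`IsRCSet.compAt`), and adding subterm steps preserves
-- termination (`terminating_rewSubterm`).
--
-- Integer mappings: on the relevant positions the instances are ground theory terms, and rewriting
-- preserves the value of such terms (`eval_of_rew`). The mapping therefore gives one integer per
-- pair; it never increases, and at each pair of `P'` it drops from a nonnegative value.
--
-- Theory arguments: once a pair of `P'` has been passed, the selected arguments are instantiated to
-- ground theory terms, and this propagates along the chain. The rest of the chain is a chain for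
-- the problem with enlarged `L`.
--
-- Reduction pairs: covering only compares κ-normal forms, so each rewrite step has to be
-- transported to normal forms. A calculation does not change the normal form. An instance of a rule
-- contains a non-theory symbol, so no term around it is a calculation redex, and normalization
-- commutes with the surrounding applications; monotonicity then applies
-- (`typedRel_calcNF_of_sharpRew`). Weak steps are absorbed into strict ones, against
-- well-foundedness.

theorem PreTerm.subst_apps {F : Type v} {V : Type w} {W : Type x} (σ : V → PreTerm F W)
    (t : PreTerm F V) (ts : List (PreTerm F V)) :
    (apps t ts).subst σ = apps (t.subst σ) (ts.map (subst σ)) := by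
  induction ts generalizing t with
  | nil => rfl
  | cons u ts ih => exact ih (app t u)

theorem PreTerm.mapSym_apps {F : Type v} {V : Type w} {G : Type x} (e : F → G)
    (t : PreTerm F V) (ts : List (PreTerm F V)) :
    (apps t ts).mapSym e = apps (t.mapSym e) (ts.map (mapSym e)) := by
  induction ts generalizing t with
  | nil => rfl
  | cons u ts ih => exact ih (app t u)

theorem PreTerm.subst_subst {F : Type u} {V : Type v} {W : Type w} {U : Type x}
    (σ : V → PreTerm F W) (τ : W → PreTerm F U) (t : PreTerm F V) :
    (t.subst σ).subst τ = t.subst fun y => (σ y).subst τ := by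
  induction t with
  | sym f => rfl
  | var y => rfl
  | app s t ihs iht => simp only [subst, ihs, iht]

theorem PreTerm.syms_subset_subst {F : Type v} {V : Type w} {W : Type x} (σ : V → PreTerm F W)
    (t : PreTerm F V) : t.syms ⊆ (t.subst σ).syms := by
  induction t with
  | sym f => exact subset_rfl
  | var y => exact Set.empty_subset _
  | app s t ihs iht => exact Set.union_subset_union ihs iht

theorem PreTerm.syms_subst_of_mem_vars {F : Type v} {V : Type w} {W : Type x}
    (σ : V → PreTerm F W) {t : PreTerm F V} {y : V} (hy : y ∈ t.vars) :
    (σ y).syms ⊆ (t.subst σ).syms ∧ (σ y).vars ⊆ (t.subst σ).vars := by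
  induction t with
  | sym f => exact hy.elim
  | var z => cases hy; exact ⟨subset_rfl, subset_rfl⟩
  | app s t ihs iht =>
    rcases hy with hy | hy
    · exact ⟨(ihs hy).1.trans Set.subset_union_left, (ihs hy).2.trans Set.subset_union_left⟩
    · exact ⟨(iht hy).1.trans Set.subset_union_right, (iht hy).2.trans Set.subset_union_right⟩

theorem PreTerm.apps_sym_ne_var {F : Type v} {V : Type w} (f : F) (ts : List (PreTerm F V))
    (y : V) : apps (sym f) ts ≠ var y :=
  fun h => LCSTRS.apps_var_ne_apps_sym y f [] ts h.symm

theorem PreTerm.apps_sym_inj {F : Type v} {V : Type w} {f g : F} {ts us : List (PreTerm F V)}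
    (h : apps (sym f) ts = apps (sym g) us) : f = g ∧ ts = us := by
  induction ts using List.reverseRecOn generalizing us with
  | nil =>
    induction us using List.reverseRecOn with
    | nil => cases h; exact ⟨rfl, rfl⟩
    | append_singleton us u _ => rw [LCSTRS.apps_snoc] at h; cases h
  | append_singleton ts t ih =>
    induction us using List.reverseRecOn with
    | nil => rw [LCSTRS.apps_snoc] at h; cases h
    | append_singleton us u _ =>
      rw [LCSTRS.apps_snoc, LCSTRS.apps_snoc] at h
      obtain ⟨h', rfl⟩ := PreTerm.app.inj h
      obtain ⟨rfl, rfl⟩ := ih h'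
      exact ⟨rfl, rfl⟩

/-- The number of applications and atoms in a term. -/
def PreTerm.size {F : Type v} {V : Type w} : PreTerm F V → ℕ
  | sym _ => 1
  | var _ => 1
  | app s t => s.size + t.size + 1

/-- The context surrounding a subterm. -/
theorem PreTerm.Subterm.exists_ctx {F : Type v} {V : Type w} {s t : PreTerm F V}
    (h : Subterm s t) : ∃ C : Ctx F V, s = C.fill t := by
  induction h with
  | refl s => exact ⟨.hole, rfl⟩
  | @arg s₀ s₁ t _ ih => obtain ⟨C, rfl⟩ := ih; exact ⟨.appR s₀ C, rfl⟩
  | @head s₀ s₁ t _ _ ih => obtain ⟨C, rfl⟩ := ih; exact ⟨.appL C s₁, rfl⟩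

theorem Ctx.size_le {F : Type v} {V : Type w} (C : Ctx F V) (t : PreTerm F V) :
    t.size ≤ (C.fill t).size := by
  induction C with
  | hole => exact le_rfl
  | appL C u ih => simp only [fill, size]; omega
  | appR u C ih => simp only [fill, size]; omega

theorem Ctx.size_lt {F : Type v} {V : Type w} {C : Ctx F V} (hC : C ≠ .hole) (t : PreTerm F V) :
    t.size < (C.fill t).size := by
  cases C with
  | hole => exact absurd rfl hC
  | appL C u => have := C.size_le t; simp only [fill, size]; omega
  | appR u C => have := C.size_le t; simp only [fill, size]; omega

/-- Application of a substitution to a context. -/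
def Ctx.subst {F : Type v} {V : Type w} (σ : V → PreTerm F V) : Ctx F V → Ctx F V
  | hole => hole
  | appL C t => appL (C.subst σ) (t.subst σ)
  | appR t C => appR (t.subst σ) (C.subst σ)

theorem Ctx.subst_fill {F : Type v} {V : Type w} (σ : V → PreTerm F V) (C : Ctx F V)
    (t : PreTerm F V) : (C.fill t).subst σ = (C.subst σ).fill (t.subst σ) := by
  induction C with
  | hole => rfl
  | appL C u ih => simp only [fill, subst, PreTerm.subst, ih]
  | appR u C ih => simp only [fill, subst, PreTerm.subst, ih]

/-- Substitution never turns a nonempty context into the hole, so a proper subterm stays proper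
after instantiation. -/
theorem PreTerm.ProperSubterm.exists_ctx {F : Type v} {V : Type w} {s t : PreTerm F V}
    (h : ProperSubterm s t) (σ : V → PreTerm F V) :
    ∃ C : Ctx F V, C ≠ .hole ∧ s.subst σ = C.fill (t.subst σ) := by
  obtain ⟨C, rfl⟩ := h.1.exists_ctx
  refine ⟨C.subst σ, ?_, C.subst_fill σ t⟩
  cases C with
  | hole => exact absurd rfl h.2
  | appL C u => exact fun h => by cases h
  | appR u C => exact fun h => by cases h

theorem PreTerm.properSubterm_apps {F : Type v} {V : Type w} (f : F) {ts : List (PreTerm F V)}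
    {t : PreTerm F V} (ht : t ∈ ts) : ProperSubterm (apps (sym f) ts) t := by
  induction ts using List.reverseRecOn with
  | nil => simp at ht
  | append_singleton ts u ih =>
    rw [LCSTRS.apps_snoc]
    -- By size, an application is not a subterm of either of its two parts.
    have key : ∀ {s₀ s₁ t : PreTerm F V}, Subterm s₀ t ∨ Subterm s₁ t → app s₀ s₁ ≠ t := by
      rintro s₀ s₁ t h rfl
      rcases h with h | h <;> obtain ⟨C, hC⟩ := h.exists_ctx <;>
        have := C.size_le (app s₀ s₁) <;> rw [← hC] at this <;> simp only [size] at this <;> omega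
    rcases List.mem_append.1 ht with ht | ht
    · have := ih ht
      exact ⟨.head this.1 this.2, key (.inl this.1)⟩
    · obtain rfl := List.mem_singleton.1 ht
      exact ⟨.arg (.refl _), key (.inr (.refl _))⟩

namespace LCSTRS

variable {S : Type u} {F : Type v} {V : Type w}

/-! ## Evaluation of ground theory terms -/

theorem syms_vars_of_eval (R : LCSTRS.{u, v, w, x} S F V) {t : PreTerm F V} {A : Ty S}
    {a : A.denote R.Dom} (h : R.Eval t A a) : t.syms ⊆ R.theorySyms ∧ t.vars = ∅ := by
  induction h with
  | sym f hf => exact ⟨Set.singleton_subset_iff.2 hf, rfl⟩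
  | app _ _ h₀ h₁ => exact ⟨Set.union_subset h₀.1 h₁.1, Set.union_empty_iff.2 ⟨h₀.2, h₁.2⟩⟩

theorem isGroundTheoryTerm_of_eval (R : LCSTRS.{u, v, w, x} S F V) {t : PreTerm F V} {A : Ty S}
    {a : A.denote R.Dom} (h : R.Eval t A a) : R.IsGroundTheoryTerm t :=
  ⟨⟨⟨A, R.hasTy_of_eval h⟩, (R.syms_vars_of_eval h).1⟩, (R.syms_vars_of_eval h).2⟩

theorem exists_eval (R : LCSTRS.{u, v, w, x} S F V) {t : PreTerm F V} {A : Ty S}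
    (h : R.HasTy t A) (hs : t.syms ⊆ R.theorySyms) (hv : t.vars = ∅) : ∃ a, R.Eval t A a := by
  induction h with
  | sym f => exact ⟨_, .sym f (hs rfl)⟩
  | var y => exact absurd hv (Set.singleton_nonempty y).ne_empty
  | app _ _ ih₀ ih₁ =>
    obtain ⟨g, hg⟩ := ih₀ (Set.subset_union_left.trans hs) (Set.union_empty_iff.1 hv).1
    obtain ⟨a, ha⟩ := ih₁ (Set.subset_union_right.trans hs) (Set.union_empty_iff.1 hv).2
    exact ⟨_, .app hg ha⟩

/-- The argument type of an application cannot be read off from its type, so the induction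
determines type and value together. -/
theorem eval_unique (R : LCSTRS.{u, v, w, x} S F V) {t : PreTerm F V} {A : Ty S}
    {a b : A.denote R.Dom} (h : R.Eval t A a) (h' : R.Eval t A b) : a = b := by
  suffices H : ∀ {B : Ty S} {b : B.denote R.Dom}, R.Eval t B b → A = B ∧ HEq a b from
    eq_of_heq (H h').2
  clear h' b
  induction h with
  | sym f hf => intro B b h'; cases h'; exact ⟨rfl, HEq.rfl⟩
  | app _ _ ih₀ ih₁ =>
    intro B b h'
    cases h' with
    | app k₀ k₁ =>
      obtain ⟨e, h₀⟩ := ih₀ k₀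
      cases e
      cases h₀
      cases (ih₁ k₁).2
      exact ⟨rfl, HEq.rfl⟩

/-- The value of a term depends only on the values of what is substituted. This serves both for
rewriting below a mapped argument and for replacing ground theory terms by values; `W` is arbitrary
because the variables of an integer mapping are argument positions. -/
theorem eval_subst_congr (R : LCSTRS.{u, v, w, x} S F V) {W : Type*} {σ τ : W → PreTerm F V}
    {t : PreTerm F W}
    (H : ∀ y ∈ t.vars, ∀ (A : Ty S) (a : A.denote R.Dom), R.Eval (σ y) A a → R.Eval (τ y) A a)
    {A : Ty S} {a : A.denote R.Dom} (h : R.Eval (t.subst σ) A a) : R.Eval (t.subst τ) A a := by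
  induction t generalizing A with
  | sym f => exact h
  | var y => exact H y rfl A a h
  | app s t ihs iht =>
    cases h with
    | app h₀ h₁ => exact .app (ihs (fun y hy => H y (.inl hy)) h₀) (iht (fun y hy => H y (.inr hy)) h₁)

/-- The left-hand side of a rule contains a non-theory symbol, which substitution cannot remove. A
ground theory term thus admits calculations only, and these preserve the value. -/
theorem eval_of_rew (R : LCSTRS.{u, v, w, x} S F V) {t t' : PreTerm F V} (h : R.Rew t t')
    {A : Ty S} {a : A.denote R.Dom} (ht : R.Eval t A a) : R.Eval t' A a := by
  obtain ⟨C, l, r, hlr, rfl, rfl⟩ := h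
  induction C generalizing A with
  | hole =>
    change R.Eval l A a at ht
    change R.Eval r A a
    rcases hlr with ⟨ρ, hρ, σ, hσ, -, rfl, rfl⟩ | ⟨f, -, vs, -, -, -, -, s, c, h₁, h₂⟩
    · obtain ⟨f, hf, hf'⟩ := (R.isRule ρ hρ).non_theory
      exact absurd ((R.syms_vars_of_eval ht).1 (syms_subset_subst σ _ hf)) hf'
    · cases hasType_unique (R.hasTy_of_eval ht) (R.hasTy_of_eval h₁)
      cases R.eval_unique ht h₁
      exact h₂
  | appL C u ih =>
    cases ht with
    | app h₀ h₁ => exact .app (ih h₀) h₁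
  | appR u C ih =>
    cases ht with
    | app h₀ h₁ => exact .app h₀ (ih h₁)

theorem eval_of_rews (R : LCSTRS.{u, v, w, x} S F V) {t t' : PreTerm F V}
    (h : Relation.ReflTransGen R.Rew t t') {A : Ty S} {a : A.denote R.Dom} (ht : R.Eval t A a) :
    R.Eval t' A a := by
  induction h with
  | refl => exact ht
  | tail _ h ih => exact R.eval_of_rew h ih

theorem isGroundTheoryTerm_iff (R : LCSTRS.{u, v, w, x} S F V) {t : PreTerm F V} :
    R.IsGroundTheoryTerm t ↔ ∃ A a, R.Eval t A a :=
  ⟨fun ⟨⟨⟨A, hA⟩, hs⟩, hv⟩ => ⟨A, R.exists_eval hA hs hv⟩,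
    fun ⟨_, _, h⟩ => R.isGroundTheoryTerm_of_eval h⟩

theorem isGroundTheoryTerm_of_isValue (R : LCSTRS.{u, v, w, x} S F V) {t : PreTerm F V}
    (h : R.IsValue t) : R.IsGroundTheoryTerm t := by
  obtain ⟨f, rfl, hf, -⟩ := h
  exact R.isGroundTheoryTerm_of_eval (.sym f hf)

theorem isGroundTheoryTerm_of_rews (R : LCSTRS.{u, v, w, x} S F V) {t t' : PreTerm F V}
    (h : Relation.ReflTransGen R.Rew t t') (ht : R.IsGroundTheoryTerm t) :
    R.IsGroundTheoryTerm t' := by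
  obtain ⟨A, a, ha⟩ := R.isGroundTheoryTerm_iff.1 ht
  exact R.isGroundTheoryTerm_of_eval (R.eval_of_rews h ha)

theorem isGroundTheoryTerm_subst (R : LCSTRS.{u, v, w, x} S F V) {σ : V → PreTerm F V}
    (hσ : R.IsSubst σ) {t : PreTerm F V} (ht : R.IsTheoryTerm t)
    (H : ∀ y ∈ t.vars, R.IsGroundTheoryTerm (σ y)) : R.IsGroundTheoryTerm (t.subst σ) := by
  obtain ⟨⟨A, hA⟩, hs⟩ := ht
  refine ⟨⟨⟨A, R.hasTy_subst hσ hA⟩, ?_⟩, ?_⟩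
  · clear hA
    induction t with
    | sym f => exact hs
    | var y => exact (H y rfl).1.2
    | app s t ihs iht =>
      exact Set.union_subset (ihs (fun y hy => H y (.inl hy)) (Set.subset_union_left.trans hs))
        (iht (fun y hy => H y (.inr hy)) (Set.subset_union_right.trans hs))
  · clear hA hs
    induction t with
    | sym f => rfl
    | var y => exact (H y rfl).2
    | app s t ihs iht =>
      exact Set.union_empty_iff.2 ⟨ihs fun y hy => H y (.inl hy), iht fun y hy => H y (.inr hy)⟩

/-- Symbols and variables of `σ y` reappear in the instance, so groundness passes back from the
instance to the variables. This lets theory arguments hand groundness on from one pair of a chain to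
the next. -/
theorem isGroundTheoryTerm_of_subst (R : LCSTRS.{u, v, w, x} S F V) {σ : V → PreTerm F V}
    (hσ : R.IsSubst σ) {t : PreTerm F V} (ht : R.IsGroundTheoryTerm (t.subst σ)) {y : V}
    (hy : y ∈ t.vars) : R.IsGroundTheoryTerm (σ y) := by
  have h := syms_subst_of_mem_vars σ hy
  exact ⟨⟨⟨_, hσ y⟩, h.1.trans ht.1.2⟩, Set.subset_eq_empty h.2 ht.2⟩

/-! ## Rewriting and termination of computable terms -/

theorem rew_appL (R : LCSTRS.{u, v, w, x} S F V) {t t' : PreTerm F V} (h : R.Rew t t')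
    (u : PreTerm F V) : R.Rew (app t u) (app t' u) := by
  obtain ⟨C, a, b, hab, rfl, rfl⟩ := h
  exact ⟨.appL C u, a, b, hab, rfl, rfl⟩

theorem rew_appR (R : LCSTRS.{u, v, w, x} S F V) {t t' : PreTerm F V} (h : R.Rew t t')
    (u : PreTerm F V) : R.Rew (app u t) (app u t') := by
  obtain ⟨C, a, b, hab, rfl, rfl⟩ := h
  exact ⟨.appR u C, a, b, hab, rfl, rfl⟩

theorem rew_fill (R : LCSTRS.{u, v, w, x} S F V) {t t' : PreTerm F V} (h : R.Rew t t')
    (C : Ctx F V) : R.Rew (C.fill t) (C.fill t') := by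
  induction C with
  | hole => exact h
  | appL C u ih => exact R.rew_appL ih u
  | appR u C ih => exact R.rew_appR ih u

theorem exists_apps_of_root (R : LCSTRS.{u, v, w, x} S F V) {t t' : PreTerm F V}
    (h : R.RuleStep t t' ∨ R.CalcStep t t') : ∃ f ts, t = apps (sym f) ts := by
  rcases h with ⟨ρ, hρ, σ, -, -, rfl, -⟩ | ⟨f, -, vs, -, -, rfl, -⟩
  · obtain ⟨f, ts, h⟩ := (R.isRule ρ hρ).head
    rw [h, subst_apps]
    exact ⟨f, _, rfl⟩
  · exact ⟨f, vs, rfl⟩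

/-- Every redex has a function symbol at its head, so a neutral term applied to an argument is not
itself a redex. -/
theorem rew_neutral_app (R : LCSTRS.{u, v, w, x} S F V) {s u t : PreTerm F V} (hs : s.IsNeutral)
    (h : R.Rew (app s u) t) :
    (∃ s', R.Rew s s' ∧ t = app s' u) ∨ ∃ u', R.Rew u u' ∧ t = app s u' := by
  obtain ⟨C, a, b, hab, e, rfl⟩ := h
  cases C with
  | hole =>
    obtain ⟨f, ts, rfl⟩ := R.exists_apps_of_root hab
    obtain ⟨y, us, rfl⟩ := hs
    rw [← apps_snoc] at e
    exact absurd e (apps_var_ne_apps_sym _ _ _ _)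
  | appL C r =>
    obtain ⟨rfl, rfl⟩ := PreTerm.app.inj e
    exact .inl ⟨_, ⟨C, a, b, hab, rfl, rfl⟩, rfl⟩
  | appR r C =>
    obtain ⟨rfl, rfl⟩ := PreTerm.app.inj e
    exact .inr ⟨_, ⟨C, a, b, hab, rfl, rfl⟩, rfl⟩

theorem not_rew_var (R : LCSTRS.{u, v, w, x} S F V) (y : V) (t : PreTerm F V) :
    ¬ R.Rew (var y) t := by
  rintro ⟨C, a, b, hab, e, -⟩
  cases C with
  | hole =>
    obtain ⟨f, ts, rfl⟩ := R.exists_apps_of_root hab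
    exact apps_sym_ne_var _ _ _ e.symm
  | appL C r => cases e
  | appR r C => cases e

/-- The three properties of reducibility candidates, lifted from sorts to all types. They need each
other: termination at an arrow type uses the neutral clause at the argument type, and the neutral
clause at an arrow type uses termination there. -/
theorem IsRCSet.compAt {R : LCSTRS.{u, v, w, x} S F V} {I : S → Set (PreTerm F V)}
    (hI : R.IsRCSet I) (A : Ty S) :
    (∀ t, R.CompAt I A t → Terminating R.Rew t) ∧
    (∀ t t', R.CompAt I A t → R.Rew t t' → R.CompAt I A t') ∧
    ∀ s, R.HasTy s A → s.IsNeutral → (∀ t, R.Rew s t → R.CompAt I A t) → R.CompAt I A s := by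
  induction A with
  | base c =>
    exact ⟨fun t h => (hI.terminating c t h.2).2,
      fun t t' h h' => ⟨R.hasTy_of_rew h' h.1, hI.closed c t h.2 t' h'⟩,
      fun s h h' H => ⟨h, hI.neutral c s h h' fun t ht => (H t ht).2⟩⟩
  | arrow A B ihA ihB =>
    refine ⟨fun t h => ?_, fun t t' h h' => ?_, fun s h h' H => ?_⟩
    · obtain ⟨y, rfl⟩ := (R.infinite_vars A).nonempty
      have hy := ihA.2.2 (var y) (.var y) ⟨y, [], rfl⟩ fun t ht => absurd ht (R.not_rew_var y t)
      have := ihB.1 _ (h.2 _ hy)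
      exact Subrelation.accessible (fun k => R.rew_appL k (var y))
        (InvImage.accessible (fun r => app r (var y)) this)
    · exact ⟨R.hasTy_of_rew h' h.1, fun u hu => ihB.2.1 _ _ (h.2 u hu) (R.rew_appL h' u)⟩
    · refine ⟨h, fun u hu => ?_⟩
      -- A step from `s u` happens in `s` or in `u`; the first case is the hypothesis on `s`, the
      -- second is covered by induction on the termination of `u`.
      induction (ihA.1 u hu) with
      | intro u _ ih =>
        obtain ⟨y, us, e⟩ := h'
        refine ihB.2.2 _ (.app h (R.hasTy_of_compAt hu)) ⟨y, us ++ [u], by rw [apps_snoc, e]⟩ ?_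
        intro t ht
        rcases R.rew_neutral_app ⟨y, us, e⟩ ht with ⟨s', hs', rfl⟩ | ⟨u', hu', rfl⟩
        · exact (H s' hs').2 u hu
        · exact ih u' hu' (ihA.2.1 _ _ hu hu')

theorem terminating_of_comp (R : LCSTRS.{u, v, w, x} S F V) (o : SortOrdering S) {t : PreTerm F V}
    (h : R.Comp (R.candSet o) t) : Terminating R.Rew t := by
  obtain ⟨A, hA⟩ := h
  exact ((R.candSet_isRCSet o).compAt A).1 t hA

/-- A rewrite step, or a step to a proper subterm (not necessarily maximally applied). -/
def RewSubterm (R : LCSTRS.{u, v, w, x} S F V) (s t : PreTerm F V) : Prop :=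
  R.Rew s t ∨ ∃ C : Ctx F V, C ≠ .hole ∧ s = C.fill t

/-- A subterm is kept together with a context that restores the whole term `t`. A rewrite step
inside it is a rewrite step of `t`, and a subterm step leaves `t` alone and makes the subterm
smaller: a lexicographic induction on termination of `t` and size. -/
theorem terminating_rewSubterm (R : LCSTRS.{u, v, w, x} S F V) {t : PreTerm F V}
    (h : Terminating R.Rew t) : Terminating R.RewSubterm t := by
  suffices H : ∀ (n : ℕ) (C : Ctx F V) (s : PreTerm F V), t = C.fill s → s.size < n →
      Terminating R.RewSubterm s from H (t.size + 1) .hole t rfl (by omega)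
  induction h with
  | intro t _ ih =>
    intro n
    induction n with
    | zero => intro C s _ h; omega
    | succ n ihn =>
      rintro C s rfl hs
      refine ⟨s, fun s' h' => ?_⟩
      rcases h' with h' | ⟨D, hD, rfl⟩
      · exact ih _ (R.rew_fill h' C) _ C s' rfl (Nat.lt_succ_self _)
      · have comp : ∀ C : Ctx F V, ∃ E : Ctx F V, C.fill (D.fill s') = E.fill s' := by
          intro C
          induction C with
          | hole => exact ⟨D, rfl⟩
          | appL C u ih => obtain ⟨E, hE⟩ := ih; exact ⟨.appL E u, congrArg (app · u) hE⟩
          | appR u C ih => obtain ⟨E, hE⟩ := ih; exact ⟨.appR u E, congrArg (app u) hE⟩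
        obtain ⟨E, hE⟩ := comp C
        exact ihn E s' hE (by have := Ctx.size_lt hD s'; omega)

/-! ## Rewriting of marked terms -/

theorem emb_inj (R : LCSTRS.{u, v, w, x} S F V) {s t : PreTerm F V} (h : R.emb s = R.emb t) :
    s = t := by
  induction s generalizing t with
  | sym f => cases t <;> simp_all [emb, mapSym]
  | var y => cases t <;> simp_all [emb, mapSym]
  | app a b iha ihb =>
    cases t with
    | sym f => cases h
    | var y => cases h
    | app c d =>
      obtain ⟨h₀, h₁⟩ := PreTerm.app.inj h
      rw [iha h₀, ihb h₁]

theorem emb_subst (R : LCSTRS.{u, v, w, x} S F V) (σ : V → PreTerm F V) (t : PreTerm F V) :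
    R.sharpSubst σ (R.emb t) = R.emb (t.subst σ) := by
  induction t with
  | sym f => rfl
  | var y => rfl
  | app s t ihs iht => exact congrArg₂ app ihs iht

theorem emb_apps (R : LCSTRS.{u, v, w, x} S F V) (t : PreTerm F V) (ts : List (PreTerm F V)) :
    R.emb (apps t ts) = apps (R.emb t) (ts.map R.emb) := mapSym_apps _ _ _

theorem rew_of_sharpRew_emb (R : LCSTRS.{u, v, w, x} S F V) {t : PreTerm F V}
    {t' : PreTerm R.SharpSym V} (h : R.SharpRew (R.emb t) t') : ∃ s, t' = R.emb s ∧ R.Rew t s := by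
  obtain ⟨C, _, _, ⟨a, b, hab, rfl, rfl⟩, e, rfl⟩ := h
  induction C generalizing t with
  | hole => cases R.emb_inj e; exact ⟨b, rfl, .hole, a, b, hab, rfl, rfl⟩
  | appL C u ih =>
    cases t with
    | sym f => cases e
    | var y => cases e
    | app t₀ t₁ =>
      obtain ⟨e₀, e₁⟩ := PreTerm.app.inj e
      obtain ⟨s, hs, hs'⟩ := ih e₀
      exact ⟨app s t₁, congrArg₂ app hs e₁.symm, R.rew_appL hs' t₁⟩
  | appR u C ih =>
    cases t with
    | sym f => cases e
    | var y => cases e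
    | app t₀ t₁ =>
      obtain ⟨e₀, e₁⟩ := PreTerm.app.inj e
      obtain ⟨s, hs, hs'⟩ := ih e₁
      exact ⟨app t₀ s, congrArg₂ app e₀.symm hs, R.rew_appR hs' t₀⟩

theorem emb_ne_apps_mark (R : LCSTRS.{u, v, w, x} S F V) (t : PreTerm F V) (f : R.DSym)
    (ts : List (PreTerm R.SharpSym V)) : R.emb t ≠ apps (sym (.inr f)) ts := by
  induction ts using List.reverseRecOn generalizing t with
  | nil => cases t <;> intro h <;> cases h
  | append_singleton ts u ih =>
    rw [apps_snoc]
    cases t with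
    | sym f => exact fun h => by cases h
    | var y => exact fun h => by cases h
    | app t₀ t₁ => exact fun h => ih t₀ (PreTerm.app.inj h).1

/-- A redex is the image of an unmarked term, so it cannot contain the marked head and lies inside a
single argument. Arguments are peeled off from the right, as application associates to the left. -/
theorem sharpRew_mark (R : LCSTRS.{u, v, w, x} S F V) {f : R.DSym} {ts : List (PreTerm F V)}
    {t' : PreTerm R.SharpSym V} (h : R.SharpRew (apps (sym (.inr f)) (ts.map R.emb)) t') :
    ∃ us, t' = apps (sym (.inr f)) (us.map R.emb) ∧
      List.Forall₂ (Relation.ReflTransGen R.Rew) ts us := by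
  induction ts using List.reverseRecOn generalizing t' with
  | nil =>
    obtain ⟨C, _, _, ⟨a, b, hab, rfl, rfl⟩, e, rfl⟩ := h
    cases C with
    | hole => exact absurd e.symm (R.emb_ne_apps_mark a f [])
    | appL C u => cases e
    | appR u C => cases e
  | append_singleton ts t ih =>
    rw [List.map_append, List.map_singleton, apps_snoc] at h
    obtain ⟨C, _, _, ⟨a, b, hab, rfl, rfl⟩, e, rfl⟩ := h
    cases C with
    | hole =>
      refine absurd e.symm ?_
      rw [← apps_snoc]
      exact R.emb_ne_apps_mark a f _
    | appL C u =>
      obtain ⟨e₀, rfl⟩ := PreTerm.app.inj e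
      obtain ⟨us, hus, hus'⟩ := ih ⟨C, _, _, ⟨a, b, hab, rfl, rfl⟩, e₀, rfl⟩
      refine ⟨us ++ [t], ?_, List.rel_append hus' (.cons .refl .nil)⟩
      rw [List.map_append, List.map_singleton, apps_snoc, ← hus]
      rfl
    | appR u C =>
      obtain ⟨rfl, e₁⟩ := PreTerm.app.inj e
      obtain ⟨s, hs, hs'⟩ := R.rew_of_sharpRew_emb ⟨C, _, _, ⟨a, b, hab, rfl, rfl⟩, e₁, rfl⟩
      refine ⟨ts ++ [s], ?_, List.rel_append (List.forall₂_same.2 fun _ _ => .refl)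
        (.cons (.single hs') .nil)⟩
      rw [List.map_append, List.map_singleton, apps_snoc, ← hs]
      rfl

theorem forall₂_trans {α : Type u} {r : α → α → Prop} (hr : ∀ a b c, r a b → r b c → r a c)
    {l m n : List α} (h : List.Forall₂ r l m) (h' : List.Forall₂ r m n) : List.Forall₂ r l n := by
  induction h generalizing n with
  | nil => exact h'
  | cons h₀ _ ih =>
    cases h' with
    | cons k₀ k => exact .cons (hr _ _ _ h₀ k₀) (ih k)

theorem sharpRews_mark (R : LCSTRS.{u, v, w, x} S F V) {f : R.DSym} {ts : List (PreTerm F V)}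
    {t' : PreTerm R.SharpSym V}
    (h : Relation.ReflTransGen R.SharpRew (apps (sym (.inr f)) (ts.map R.emb)) t') :
    ∃ us, t' = apps (sym (.inr f)) (us.map R.emb) ∧
      List.Forall₂ (Relation.ReflTransGen R.Rew) ts us := by
  induction h with
  | refl => exact ⟨ts, rfl, List.forall₂_same.2 fun _ _ => .refl⟩
  | tail _ h ih =>
    obtain ⟨us, rfl, hus⟩ := ih
    obtain ⟨vs, rfl, hvs⟩ := R.sharpRew_mark h
    exact ⟨vs, rfl, forall₂_trans (fun _ _ _ => .trans) hus hvs⟩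

theorem sharpSubst_toTerm (R : LCSTRS.{u, v, w, x} S F V) (σ : V → PreTerm F V) (t : R.DPTerm) :
    R.sharpSubst σ t.toTerm =
      apps (sym (.inr t.head)) ((List.ofFn fun i => (t.args i).subst σ).map R.emb) := by
  rw [sharpSubst, DPTerm.toTerm, subst_apps, List.map_ofFn, List.map_ofFn]
  congr 2
  funext i
  exact R.emb_subst σ (t.args i)

/-- A reduction between instances of terms of type `dp` takes place in the arguments. -/
theorem rews_args (R : LCSTRS.{u, v, w, x} S F V) {σ τ : V → PreTerm F V} {t s : R.DPTerm}
    (h : Relation.ReflTransGen R.SharpRew (R.sharpSubst σ t.toTerm) (R.sharpSubst τ s.toTerm)) :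
    ∃ e : t.head = s.head, ∀ i : Fin (R.arity t.head),
      Relation.ReflTransGen R.Rew ((t.args i).subst σ) ((s.args (e ▸ i)).subst τ) := by
  rw [sharpSubst_toTerm, sharpSubst_toTerm] at h
  obtain ⟨us, hus, hus'⟩ := R.sharpRews_mark h
  obtain ⟨e, e'⟩ := apps_sym_inj hus
  obtain ⟨f, as, ha⟩ := t
  obtain ⟨g, bs, hb⟩ := s
  obtain rfl : g = f := Sum.inr_injective e
  obtain rfl := List.map_injective_iff.2 (fun _ _ => R.emb_inj) e'
  refine ⟨rfl, fun i => ?_⟩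
  refine forall₂_get hus' (k := i) ?_ ?_ <;> simp

end LCSTRS

-- Substitution between different sets of variables; infinite reduction sequences

theorem PreTerm.hasType_subst {T : Type u} {F : Type v} {V : Type w} {W : Type x}
    {symTy : F → Ty T} {varTy : V → Ty T} {varTy' : W → Ty T} {σ : V → PreTerm F W}
    (hσ : ∀ y, HasType symTy varTy' (σ y) (varTy y)) {t : PreTerm F V} {A : Ty T}
    (h : HasType symTy varTy t A) : HasType symTy varTy' (t.subst σ) A := by
  induction h with
  | sym f => exact .sym f
  | var y => exact hσ y
  | app _ _ h₀ h₁ => exact .app h₀ h₁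

theorem PreTerm.syms_subst_subset {F : Type v} {V : Type w} {W : Type x} {σ : V → PreTerm F W}
    {t : PreTerm F V} {M : Set F} (ht : t.syms ⊆ M) (hσ : ∀ y ∈ t.vars, (σ y).syms ⊆ M) :
    (t.subst σ).syms ⊆ M := by
  induction t with
  | sym f => exact ht
  | var y => exact hσ y rfl
  | app s t ihs iht =>
    exact Set.union_subset (ihs (Set.subset_union_left.trans ht) fun y hy => hσ y (.inl hy))
      (iht (Set.subset_union_right.trans ht) fun y hy => hσ y (.inr hy))

theorem PreTerm.vars_subst_subset {F : Type v} {V : Type w} {W : Type x} {σ : V → PreTerm F W}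
    {t : PreTerm F V} {M : Set W} (hσ : ∀ y ∈ t.vars, (σ y).vars ⊆ M) :
    (t.subst σ).vars ⊆ M := by
  induction t with
  | sym f => exact Set.empty_subset _
  | var y => exact hσ y rfl
  | app s t ihs iht =>
    exact Set.union_subset (ihs fun y hy => hσ y (.inl hy)) (iht fun y hy => hσ y (.inr hy))

/-- An infinite sequence of `r`-reductions, infinitely many of which are nonempty, does not meet
the terminating elements. -/
theorem not_terminating_of_frequently {α : Type u} {r : α → α → Prop} {a : ℕ → α}
    (h : ∀ i, Relation.ReflTransGen r (a i) (a (i + 1)))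
    (h' : ∀ n, ∃ m, n ≤ m ∧ Relation.TransGen r (a m) (a (m + 1))) (n : ℕ) :
    ¬ Terminating r (a n) := by
  intro hn
  -- In the transitive closure, `a (m + 1)` is strictly below `a n`, whatever the empty steps in
  -- between.
  replace hn := Acc.transGen hn
  generalize e : a n = b at hn
  induction hn generalizing n with
  | intro b _ ih =>
    subst e
    obtain ⟨m, hnm, hm⟩ := h' n
    have hnm' : Relation.ReflTransGen r (a n) (a m) :=
      Nat.le_induction (P := fun k _ => Relation.ReflTransGen r (a n) (a k)) .refl
        (fun k _ hk => hk.trans (h k)) m hnm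
    exact ih _ (Relation.transGen_swap.2 (.trans_right hnm' hm)) (m + 1) rfl

namespace LCSTRS

variable {S : Type u} {F : Type v} {V : Type w}

/-! ## Infinite chains -/

theorem isChain_top (R : LCSTRS.{u, v, w, x} S F V) {P : Set R.SDP}
    {c : ℕ → R.SDP × (V → PreTerm F V)} : R.IsChain P ⊤ c ↔
      (∀ i, (c i).1 ∈ P ∧ R.RespectsOn (c i).1.cond (c i).1.L (c i).2) ∧
      ∀ i, Relation.ReflTransGen R.SharpRew (R.sharpSubst (c i).2 (c i).1.rhs.toTerm)
        (R.sharpSubst (c (i + 1)).2 (c (i + 1)).1.lhs.toTerm) :=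
  ⟨fun h => ⟨fun i => h.1 i (ENat.natCast_lt_top i), fun i => h.2 i (ENat.natCast_lt_top _)⟩,
    fun h => ⟨fun i _ => h.1 i, fun i _ => h.2 i⟩⟩

theorem IsComputableChain.top {R : LCSTRS.{u, v, w, x} S F V} {o : SortOrdering S}
    {c : ℕ → R.SDP × (V → PreTerm F V)} (h : R.IsComputableChain o ⊤ c) (i : ℕ) {t : PreTerm F V}
    (ht : ProperSubterm (c i).1.rhs.unmark t) : R.Comp (R.candSet o) (t.subst (c i).2) :=
  h i (ENat.natCast_lt_top i) t ht

/-- Otherwise the tail from `n` on would be an infinite computable chain for `P'`. -/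
theorem IsFinite.exists_notMem {R : LCSTRS.{u, v, w, x} S F V} {o : SortOrdering S}
    {P P' : Set R.SDP} {c : ℕ → R.SDP × (V → PreTerm F V)} (hP' : R.IsFinite o P')
    (hc : R.IsChain P ⊤ c) (hc' : R.IsComputableChain o ⊤ c) (n : ℕ) :
    ∃ m, n ≤ m ∧ (c m).1 ∉ P' := by
  by_contra! H
  obtain ⟨h₀, h₁⟩ := R.isChain_top.1 hc
  exact hP' ⟨fun i => c (n + i), R.isChain_top.2
    ⟨fun i => ⟨H _ (Nat.le_add_right n i), (h₀ _).2⟩, fun i => h₁ (n + i)⟩,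
    fun i _ t ht => hc'.top _ ht⟩

theorem IsFinite.exists_mem {R : LCSTRS.{u, v, w, x} S F V} {o : SortOrdering S}
    {P P' : Set R.SDP} {c : ℕ → R.SDP × (V → PreTerm F V)} (hP' : R.IsFinite o (P \ P'))
    (hc : R.IsChain P ⊤ c) (hc' : R.IsComputableChain o ⊤ c) (n : ℕ) :
    ∃ m, n ≤ m ∧ (c m).1 ∈ P' := by
  obtain ⟨m, hm, h⟩ := hP'.exists_notMem hc hc' n
  exact ⟨m, hm, by_contra fun k => h ⟨((R.isChain_top.1 hc).1 m).1, k⟩⟩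

/-! ## Graph processors -/

theorem IsGraphProcessor.sound {R : LCSTRS.{u, v, w, x} S F V} {ρ : R.Processor}
    (h : R.IsGraphProcessor ρ) (o : SortOrdering S) : R.Sound o ρ := by
  rintro P Q hPQ hQ ⟨c, hc, hc'⟩
  obtain ⟨N, E, θ, ⟨hN, hθ⟩, rfl⟩ := h P Q hPQ
  obtain ⟨h₀, h₁⟩ := R.isChain_top.1 hc
  let a : ℕ → N := fun i => θ ⟨(c i).1, (h₀ i).1⟩
  -- Two consecutive entries form a chain of length 2, which is all the graph approximation needs.
  have hE : ∀ i, E (a i) (a (i + 1)) := fun i =>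
    hθ _ _ ⟨fun j => c (i + j), ⟨fun j _ => h₀ _, fun j _ => h₁ (i + j)⟩, rfl, rfl⟩
  have hreach : ∀ i j, i ≤ j → Relation.ReflTransGen E (a i) (a j) := fun i j hij =>
    Nat.le_induction (P := fun k _ => Relation.ReflTransGen E (a i) (a k)) .refl
      (fun k _ hk => hk.tail (hE k)) j hij
  obtain ⟨b, hb⟩ := Finite.exists_infinite_fiber a
  have hinf : (a ⁻¹' {b}).Infinite := Set.infinite_coe_iff.1 hb
  obtain ⟨n, hn⟩ := hinf.nonempty
  -- From index `n` on, every vertex of the path lies between two visits to the recurring vertex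
  -- `b`.
  have hmem : ∀ i, n ≤ i → Relation.ReflTransGen E b (a i) ∧ Relation.ReflTransGen E (a i) b := by
    intro i hi
    obtain ⟨m, hm, him⟩ := hinf.exists_gt i
    exact ⟨hn ▸ hreach n i hi, hm ▸ hreach i m him.le⟩
  -- The component of `b` is non-trivial: it contains the edge from `a n` to `a (n + 1)`.
  obtain ⟨m, hm, hm'⟩ := (hQ _ ⟨{d | Relation.ReflTransGen E b d ∧ Relation.ReflTransGen E d b},
    ⟨⟨b, rfl⟩, a n, hmem n le_rfl, a (n + 1), hmem _ (Nat.le_succ n), hE n⟩, rfl⟩).exists_notMem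
    hc hc' n
  exact hm' ⟨(h₀ m).1, hmem m hm⟩

/-! ## Subterm criterion processors -/

theorem projection_cast (R : LCSTRS.{u, v, w, x} S F V) {P : Set R.SDP} (ν : R.Projection P)
    {f g : R.DSym} (e : f = g) (hf : f ∈ R.heads P) (hg : g ∈ R.heads P) :
    (e ▸ ν f hf : Fin (R.arity g)) = ν g hg := by
  subst e
  rfl

theorem IsSubtermProcessor.sound {R : LCSTRS.{u, v, w, x} S F V} {ρ : R.Processor}
    (h : R.IsSubtermProcessor ρ) (o : SortOrdering S) : R.Sound o ρ := by
  rintro P Q hPQ hQ ⟨c, hc, hc'⟩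
  obtain ⟨P', -, -, ⟨ν, hν⟩, rfl⟩ := h P Q hPQ
  have hinf := (hQ _ rfl).exists_mem hc hc'
  obtain ⟨h₀, h₁⟩ := R.isChain_top.1 hc
  let l : ℕ → PreTerm F V := fun i =>
    ((c i).1.lhs.args (ν _ (R.lhs_head_mem (h₀ i).1))).subst (c i).2
  let r : ℕ → PreTerm F V := fun i =>
    ((c i).1.rhs.args (ν _ (R.rhs_head_mem (h₀ i).1))).subst (c i).2
  have hrl : ∀ i, Relation.ReflTransGen R.RewSubterm (r i) (l (i + 1)) := by
    intro i
    obtain ⟨e, he⟩ := R.rews_args (h₁ i)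
    have := he (ν _ (R.rhs_head_mem (h₀ i).1))
    rw [R.projection_cast ν e _ (R.lhs_head_mem (h₀ (i + 1)).1)] at this
    exact Relation.ReflTransGen.mono (fun _ _ => .inl) _ _ this
  have hlt : ∀ i, (c i).1 ∈ P' → R.RewSubterm (l i) (r i) := fun i hi =>
    .inr (((hν _ (h₀ i).1).1 hi).exists_ctx (c i).2)
  have hle : ∀ i, Relation.ReflTransGen R.RewSubterm (l i) (r i) := by
    intro i
    by_cases hi : (c i).1 ∈ P'
    · exact .single (hlt i hi)
    · have := congrArg (subst (c i).2) ((hν _ (h₀ i).1).2 hi)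
      change l i = r i at this
      rw [this]
  -- The contradiction is drawn at index 1. Computability of a chain concerns right-hand sides only,
  -- so `l 0` need not terminate, whereas `l 1` is reached from the computable term `r 0`.
  refine not_terminating_of_frequently (a := l) (r := R.RewSubterm)
    (fun i => (hle i).trans (hrl i)) (fun n => ?_) 1 ?_
  · obtain ⟨m, hm, hm'⟩ := hinf n
    exact ⟨m, hm, .head' (hlt m hm') (hrl m)⟩
  · have h₂ : Terminating R.RewSubterm (r 0) := by
      refine R.terminating_rewSubterm (R.terminating_of_comp o (hc'.top 0 ?_))
      exact properSubterm_apps _ (List.mem_ofFn.2 ⟨_, rfl⟩)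
    have h₃ : ∀ t, Relation.ReflTransGen R.RewSubterm (r 0) t → Terminating R.RewSubterm t := by
      intro t ht
      induction ht with
      | refl => exact h₂
      | tail _ h ih => exact ih.inv h
    exact h₃ _ (hrl 0)

/-! ## Integer mapping processors -/

/-- A substitution that maps the theory variables in `L` to ground theory terms can be replaced by
one that maps them to values. -/
theorem exists_value_subst (R : LCSTRS.{u, v, w, x} S F V) {L : Set V} {σ : V → PreTerm F V}
    (hσ : R.IsSubst σ) (hL : ∀ y ∈ L, R.IsTheoryVar y) (h : ∀ y ∈ L, R.IsGroundTheoryTerm (σ y)) :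
    ∃ τ, R.IsSubst τ ∧ (∀ y ∈ L, R.IsValue (τ y)) ∧
      ∀ y ∈ L, ∀ (A : Ty S) (a : A.denote R.Dom), R.Eval (σ y) A a → R.Eval (τ y) A a := by
  have key : ∀ y, ∃ t, R.HasTy t (R.varTy y) ∧ (y ∈ L → R.IsValue t ∧
      ∀ (A : Ty S) (a : A.denote R.Dom), R.Eval (σ y) A a → R.Eval t A a) := by
    intro y
    by_cases hy : y ∈ L
    · obtain ⟨s, hs, e⟩ := hL y hy
      have hty := hσ y
      rw [e] at hty ⊢
      obtain ⟨a, ha⟩ := R.exists_eval hty (h y hy).1.2 (h y hy).2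
      -- Each element of a theory sort is named by a value; take the one naming the denotation of `σ
      -- y`.
      obtain ⟨f, ⟨hf, hfa⟩, -⟩ := R.interp_bijective s hs a
      refine ⟨sym f, R.hasTy_of_eval hfa, fun _ => ⟨⟨f, rfl, hf⟩, fun A b hb => ?_⟩⟩
      cases hasType_unique hty (R.hasTy_of_eval hb)
      exact R.eval_unique ha hb ▸ hfa
    · exact ⟨σ y, hσ y, fun k => absurd k hy⟩
  choose τ hτ hτ' using key
  exact ⟨τ, hτ, fun y hy => (hτ' y hy).1, fun y hy => (hτ' y hy).2⟩

theorem isTrue_of_isTrue (R : LCSTRS.{u, v, w, x} S F V) {b : Bool} {t : PreTerm F V}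
    (h : R.IsTrue t) (h' : R.Eval t (.base R.bool) (R.boolEquiv.symm b)) : b = true :=
  R.boolEquiv.symm.injective (R.eval_unique h' h)

theorem IntTheory.le_of_isTrue_ge {R : LCSTRS.{u, v, w, x} S F V} (Z : R.IntTheory)
    {s t : PreTerm F V} {a b : R.Dom Z.int} (hs : R.Eval s (.base Z.int) a)
    (ht : R.Eval t (.base Z.int) b) (h : R.IsTrue (Z.ge s t)) : Z.intEquiv b ≤ Z.intEquiv a :=
  of_decide_eq_true (R.isTrue_of_isTrue h (.app (.app Z.ge_eval hs) ht))

theorem IntTheory.and_of_isTrue {R : LCSTRS.{u, v, w, x} S F V} (Z : R.IntTheory)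
    {r s t : PreTerm F V} {a b c : R.Dom Z.int} (hr : R.Eval r (.base Z.int) a)
    (hs : R.Eval s (.base Z.int) b) (ht : R.Eval t (.base Z.int) c)
    (h : R.IsTrue (Z.and (Z.ge r s) (Z.gt r t))) :
    Z.intEquiv b ≤ Z.intEquiv a ∧ Z.intEquiv c < Z.intEquiv a := by
  have := R.isTrue_of_isTrue h (.app (.app Z.and_eval (.app (.app Z.ge_eval hr) hs))
    (.app (.app Z.gt_eval hr) ht))
  simpa using this

/-- The positions in `theoryPos` are chosen so that the mapped term is a theory term over `L`. A
substitution from a chain hence makes it ground. -/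
theorem isTheoryTerm_intVal (R : LCSTRS.{u, v, w, x} S F V) {Z : R.IntTheory} {P : Set R.SDP}
    {J : (f : R.DSym) → PreTerm F (Fin (R.arity f))} (hJ : R.IsIntMapping Z P J) {p : R.SDP}
    (hp : p ∈ P) {t : R.DPTerm} (ht : t = p.lhs ∨ t = p.rhs) :
    R.HasTy (R.intVal J t) (.base Z.int) ∧ (R.intVal J t).syms ⊆ R.theorySyms ∧
      (R.intVal J t).vars ⊆ p.L := by
  obtain ⟨h₀, h₁, h₂⟩ := hJ t.head (by rcases ht with rfl | rfl; exacts [⟨p, hp, .inl rfl⟩,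
    ⟨p, hp, .inr rfl⟩])
  exact ⟨hasType_subst t.typed h₀,
    syms_subst_subset h₁ fun i hi => ((h₂ hi).2 p hp t ht rfl).1.2,
    vars_subst_subset fun i hi => ((h₂ hi).2 p hp t ht rfl).2⟩

theorem IsIntProcessor.sound {R : LCSTRS.{u, v, w, x} S F V} {Z : R.IntTheory} {ρ : R.Processor}
    (h : R.IsIntProcessor Z ρ) (o : SortOrdering S) : R.Sound o ρ := by
  rintro P Q hPQ hQ ⟨c, hc, hc'⟩
  obtain ⟨P', -, -, ⟨J, hJ, hor⟩, rfl⟩ := h P Q hPQ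
  have hinf := (hQ _ rfl).exists_mem hc hc'
  obtain ⟨h₀, h₁⟩ := R.isChain_top.1 hc
  have hev : ∀ i (t : R.DPTerm), t = (c i).1.lhs ∨ t = (c i).1.rhs →
      ∃ a : R.Dom Z.int, R.Eval ((R.intVal J t).subst (c i).2) (.base Z.int) a := by
    intro i t ht
    obtain ⟨k₀, k₁, k₂⟩ := R.isTheoryTerm_intVal hJ (h₀ i).1 ht
    obtain ⟨hσ, hL, -⟩ := (h₀ i).2
    have := R.isGroundTheoryTerm_subst hσ ⟨⟨_, k₀⟩, k₁⟩ fun y hy => hL y (k₂ hy)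
    exact R.exists_eval (R.hasTy_subst hσ k₀) this.1.2 this.2
  choose a ha using fun i => hev i _ (.inl rfl)
  choose b hb using fun i => hev i _ (.inr rfl)
  -- The mapping sees only arguments instantiated to ground theory terms, and the reduction to the
  -- next pair preserves their values.
  have hba : ∀ i, b i = a (i + 1) := by
    intro i
    refine R.eval_unique (t := (R.intVal J (c (i + 1)).1.lhs).subst (c (i + 1)).2) ?_ (ha (i + 1))
    obtain ⟨e, he⟩ := R.rews_args (h₁ i)
    have hbi := hb i
    generalize (c i).1.rhs = t at e he hbi
    generalize (c (i + 1)).1.lhs = s at e he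
    obtain ⟨f, ts, ht⟩ := t
    obtain ⟨g, ss, hs⟩ := s
    obtain rfl : f = g := e
    rw [intVal, subst_subst] at hbi ⊢
    exact R.eval_subst_congr (fun j _ A d hd => R.eval_of_rews (he j) hd) hbi
  have hval : ∀ i, ((c i).1 ∈ P' →
      0 ≤ Z.intEquiv (a i) ∧ Z.intEquiv (b i) < Z.intEquiv (a i)) ∧
      Z.intEquiv (b i) ≤ Z.intEquiv (a i) := by
    intro i
    obtain ⟨hσ, hL, htrue⟩ := (h₀ i).2
    -- Entailment speaks of values only, while a chain instantiates `L` by ground theory terms; `τ`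
    -- has the same denotations on `L`.
    obtain ⟨τ, hτ, hτv, hτe⟩ := R.exists_value_subst hσ (c i).1.theoryVars hL
    obtain ⟨-, -, kl⟩ := R.isTheoryTerm_intVal hJ (h₀ i).1 (.inl rfl)
    obtain ⟨-, -, kr⟩ := R.isTheoryTerm_intVal hJ (h₀ i).1 (.inr rfl)
    have ha' := R.eval_subst_congr (fun y hy => hτe y (kl hy)) (ha i)
    have hb' := R.eval_subst_congr (fun y hy => hτe y (kr hy)) (hb i)
    have htrue' : R.IsTrue ((c i).1.cond.subst τ) :=
      R.eval_subst_congr (fun y hy => hτe y ((c i).1.vars_subset hy)) htrue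
    obtain ⟨o₁, o₂⟩ := hor _ (h₀ i).1
    have hstrict : (c i).1 ∈ P' →
        0 ≤ Z.intEquiv (a i) ∧ Z.intEquiv (b i) < Z.intEquiv (a i) := by
      intro hi
      have := o₁ hi τ hτ (fun y hy => hτv y ?_) htrue'
      · have := Z.and_of_isTrue ha' Z.zero_eval hb' this
        rwa [Equiv.apply_symm_apply] at this
      · simp only [IntTheory.and, IntTheory.ge, IntTheory.gt, apps, List.foldl, vars,
          Set.mem_union, Set.mem_empty_iff_false, false_or, or_false] at hy
        rcases hy with hy | hy | hy | hy
        exacts [(c i).1.vars_subset hy, kl hy, kl hy, kr hy]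
    refine ⟨hstrict, ?_⟩
    by_cases hi : (c i).1 ∈ P'
    · exact (hstrict hi).2.le
    · refine Z.le_of_isTrue_ge ha' hb' (o₂ hi τ hτ (fun y hy => hτv y ?_) htrue')
      simp only [IntTheory.ge, apps, List.foldl, vars, Set.mem_union, Set.mem_empty_iff_false,
        false_or] at hy
      rcases hy with hy | hy | hy
      exacts [(c i).1.vars_subset hy, kl hy, kr hy]
  -- The shift by 1 makes a drop from `0` to a negative integer visible after truncation to natural
  -- numbers.
  refine not_terminating_of_frequently (a := fun i => (Z.intEquiv (a i) + 1).toNat)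
    (r := fun m n : ℕ => n < m) (fun i => ?_) (fun n => ?_) 0 (Nat.lt_wfRel.wf.apply _)
  · have := (hval i).2
    rw [hba] at this
    rcases (Int.toNat_le_toNat (add_le_add_left this 1)).eq_or_lt with h | h
    · exact h ▸ .refl
    · exact .single h
  · obtain ⟨m, hm, hm'⟩ := hinf n
    have := (hval m).1 hm'
    rw [hba] at this
    exact ⟨m, hm, .single (by omega)⟩

/-! ## Theory argument processors -/

theorem IsTheoryArgProcessor.sound {R : LCSTRS.{u, v, w, x} S F V} {ρ : R.Processor}
    (h : R.IsTheoryArgProcessor ρ) (o : SortOrdering S) : R.Sound o ρ := by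
  rintro P Q hPQ hQ ⟨c, hc, hc'⟩
  obtain ⟨P', -, -, τ, ⟨-, hτl, hτr⟩, hfix, rfl⟩ := h P Q hPQ
  obtain ⟨k, -, hk⟩ := (hQ _ (.inr rfl)).exists_mem hc hc' 0
  obtain ⟨h₀, h₁⟩ := R.isChain_top.1 hc
  -- If the selected arguments on the right become ground theory terms, so do their reducts, which
  -- are the instances of the selected arguments on the next left-hand side.
  have hrhs : ∀ i, (∀ j ∈ τ (c i).1.rhs.head, ∀ y ∈ ((c i).1.rhs.args j).vars,
      R.IsGroundTheoryTerm ((c i).2 y)) →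
      ∀ y ∈ R.theoryArgVars τ (c (i + 1)).1.lhs, R.IsGroundTheoryTerm ((c (i + 1)).2 y) := by
    intro i hi y hy
    obtain ⟨j, hj, hy'⟩ := Set.mem_iUnion₂.1 hy
    refine R.isGroundTheoryTerm_of_subst (h₀ (i + 1)).2.1 ?_ hy'
    obtain ⟨e, he⟩ := R.rews_args (h₁ i)
    have hth := fun j hj => (hτr _ (h₀ i).1 j hj).1
    have hσ := (h₀ i).2.1
    clear hy hy'
    generalize (c i).1.rhs = t at e he hi hth
    generalize (c (i + 1)).1.lhs = s at e he j hj
    obtain ⟨f, ts, ht⟩ := t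
    obtain ⟨g, ss, hs⟩ := s
    obtain rfl : f = g := e
    exact R.isGroundTheoryTerm_of_rews (he j)
      (R.isGroundTheoryTerm_subst hσ (hth j hj) (hi j hj))
  -- The pair at `k` starts the propagation, since it is fixed: the variables of its selected right
  -- arguments lie in `L`. Each later pair passes groundness from its selected left arguments and
  -- `L` to its selected right arguments.
  have hall : ∀ i, ∀ y ∈ R.theoryArgVars τ (c (k + 1 + i)).1.lhs,
      R.IsGroundTheoryTerm ((c (k + 1 + i)).2 y) := by
    intro i
    induction i with
    | zero =>
      exact hrhs k fun j hj y hy => (h₀ k).2.2.1 y (hfix _ hk (Set.mem_biUnion hj hy))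
    | succ i ih =>
      refine hrhs (k + 1 + i) fun j hj y hy => ?_
      rcases (hτr _ (h₀ _).1 j hj).2 hy with hy | hy
      · exact (h₀ _).2.2.1 y hy
      · exact ih y hy
  let ext : {p // p ∈ P} → R.SDP := fun p =>
    { p.1 with
      L := p.1.L ∪ R.theoryArgVars τ p.1.lhs
      theoryVars := by
        rintro y (hy | hy)
        · exact p.1.theoryVars y hy
        · obtain ⟨j, hj, hy⟩ := Set.mem_iUnion₂.1 hy
          exact (hτl _ p.2 j hj).2 y hy
      vars_subset := p.1.vars_subset.trans Set.subset_union_left }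
  -- The new chain begins just after the fixing pair. Only `L` has changed, so reductions and
  -- computability carry over.
  refine hQ _ (.inl rfl) ⟨fun i => (ext ⟨(c (k + 1 + i)).1, (h₀ _).1⟩, (c (k + 1 + i)).2),
    R.isChain_top.2 ⟨fun i => ⟨⟨_, (h₀ (k + 1 + i)).1, rfl, rfl, rfl, rfl⟩,
      (h₀ (k + 1 + i)).2.1, ?_, (h₀ (k + 1 + i)).2.2.2⟩, fun i => h₁ (k + 1 + i)⟩,
    fun i _ t ht => hc'.top (k + 1 + i) ht⟩
  rintro y (hy | hy)
  · exact (h₀ _).2.2.1 y hy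
  · exact hall i y hy

/-! ## Normal forms with respect to calculation -/

/-- Calculation steps at the root, on terms over the extended set of function symbols. -/
def CalcRoot (R : LCSTRS.{u, v, w, x} S F V) (t t' : PreTerm R.SharpSym V) : Prop :=
  ∃ a b, R.CalcStep a b ∧ t = R.emb a ∧ t' = R.emb b

open Classical in
/-- The normal form with respect to calculation, computed innermost. -/
noncomputable def calcNF (R : LCSTRS.{u, v, w, x} S F V) :
    PreTerm R.SharpSym V → PreTerm R.SharpSym V
  | sym f => sym f
  | var y => var y
  | app s t =>
    if h : ∃ u, R.CalcRoot (app (R.calcNF s) (R.calcNF t)) u then h.choose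
    else app (R.calcNF s) (R.calcNF t)

/-- The result is a value, and values of a theory sort are determined by their interpretation. -/
theorem calcStep_unique (R : LCSTRS.{u, v, w, x} S F V) {t a b : PreTerm F V}
    (ha : R.CalcStep t a) (hb : R.CalcStep t b) : a = b := by
  obtain ⟨-, -, -, -, -, -, ⟨f, rfl, hf⟩, s, c, ht, hfc⟩ := ha
  obtain ⟨-, -, -, -, -, -, ⟨g, rfl, hg⟩, s', c', ht', hgc⟩ := hb
  cases hasType_unique (R.hasTy_of_eval ht) (R.hasTy_of_eval ht')
  cases R.eval_unique ht ht'
  have hs : s ∈ R.theorySorts := by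
    have := R.theorySyms_ty f hf.1
    rwa [hasType_unique (.sym f) (R.hasTy_of_eval hfc)] at this
  rw [(R.interp_bijective s hs c).unique ⟨hf, hfc⟩ ⟨hg, hgc⟩]

theorem CalcRoot.unique {R : LCSTRS.{u, v, w, x} S F V} {t a b : PreTerm R.SharpSym V}
    (ha : R.CalcRoot t a) (hb : R.CalcRoot t b) : a = b := by
  obtain ⟨t, a, ha, rfl, rfl⟩ := ha
  obtain ⟨t', b, hb, e, rfl⟩ := hb
  cases R.emb_inj e
  rw [R.calcStep_unique ha hb]

theorem not_calcRoot_sym (R : LCSTRS.{u, v, w, x} S F V) (f : R.SharpSym)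
    (t : PreTerm R.SharpSym V) : ¬ R.CalcRoot (sym f) t := by
  rintro ⟨a, b, ⟨g, -, vs, hvs, -, rfl, -⟩, e, -⟩
  obtain ⟨us, u, rfl⟩ := List.eq_nil_or_concat vs |>.resolve_left hvs
  rw [List.concat_eq_append, apps_snoc] at e
  cases e

theorem not_calcRoot_var (R : LCSTRS.{u, v, w, x} S F V) (y : V)
    (t : PreTerm R.SharpSym V) : ¬ R.CalcRoot (var y) t := by
  rintro ⟨a, b, ⟨g, -, vs, hvs, -, rfl, -⟩, e, -⟩
  rw [R.emb_apps] at e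
  exact apps_sym_ne_var _ _ _ e.symm

theorem calcNF_app_of_calcRoot (R : LCSTRS.{u, v, w, x} S F V) {s t u : PreTerm R.SharpSym V}
    (h : R.CalcRoot (app (R.calcNF s) (R.calcNF t)) u) : R.calcNF (app s t) = u := by
  have h' : ∃ u, R.CalcRoot (app (R.calcNF s) (R.calcNF t)) u := ⟨u, h⟩
  rw [calcNF, dif_pos h']
  exact h'.choose_spec.unique h

theorem calcNF_app_of_not_calcRoot (R : LCSTRS.{u, v, w, x} S F V) {s t : PreTerm R.SharpSym V}
    (h : ∀ u, ¬ R.CalcRoot (app (R.calcNF s) (R.calcNF t)) u) :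
    R.calcNF (app s t) = app (R.calcNF s) (R.calcNF t) := by
  rw [calcNF, dif_neg fun ⟨u, hu⟩ => h u hu]

theorem sharpCalc_appL (R : LCSTRS.{u, v, w, x} S F V) {s t : PreTerm R.SharpSym V}
    (h : R.SharpCalc s t) (u : PreTerm R.SharpSym V) : R.SharpCalc (app s u) (app t u) := by
  obtain ⟨C, a, b, hab, rfl, rfl⟩ := h
  exact ⟨.appL C u, a, b, hab, rfl, rfl⟩

theorem sharpCalc_appR (R : LCSTRS.{u, v, w, x} S F V) {s t : PreTerm R.SharpSym V}
    (h : R.SharpCalc s t) (u : PreTerm R.SharpSym V) : R.SharpCalc (app u s) (app u t) := by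
  obtain ⟨C, a, b, hab, rfl, rfl⟩ := h
  exact ⟨.appR u C, a, b, hab, rfl, rfl⟩

theorem sharpCalcs_app_calcNF (R : LCSTRS.{u, v, w, x} S F V) (s t : PreTerm R.SharpSym V) :
    Relation.ReflTransGen R.SharpCalc (app (R.calcNF s) (R.calcNF t)) (R.calcNF (app s t)) := by
  by_cases h : ∃ u, R.CalcRoot (app (R.calcNF s) (R.calcNF t)) u
  · obtain ⟨u, hu⟩ := h
    rw [R.calcNF_app_of_calcRoot hu]
    exact .single ⟨.hole, _, _, hu, rfl, rfl⟩
  · rw [R.calcNF_app_of_not_calcRoot (not_exists.1 h)]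

theorem sharpCalcs_calcNF (R : LCSTRS.{u, v, w, x} S F V) (t : PreTerm R.SharpSym V) :
    Relation.ReflTransGen R.SharpCalc t (R.calcNF t) := by
  induction t with
  | sym f => exact .refl
  | var y => exact .refl
  | app s t ihs iht =>
    have h₀ : Relation.ReflTransGen R.SharpCalc (app s t) (app (R.calcNF s) t) :=
      ihs.lift (fun s => app s t) fun _ _ h => R.sharpCalc_appL h t
    have h₁ : Relation.ReflTransGen R.SharpCalc (app (R.calcNF s) t)
        (app (R.calcNF s) (R.calcNF t)) :=
      iht.lift (app (R.calcNF s)) fun _ _ h => R.sharpCalc_appR h _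
    exact (h₀.trans h₁).trans (R.sharpCalcs_app_calcNF s t)

theorem not_sharpCalc_calcNF (R : LCSTRS.{u, v, w, x} S F V) (t u : PreTerm R.SharpSym V) :
    ¬ R.SharpCalc (R.calcNF t) u := by
  have hsym : ∀ (f : R.SharpSym) u, ¬ R.SharpCalc (sym f) u := by
    rintro f u ⟨C, a, b, hab, e, -⟩
    cases C with
    | hole => cases e; exact R.not_calcRoot_sym f b hab
    | appL C r => cases e
    | appR r C => cases e
  induction t generalizing u with
  | sym f => exact hsym f u
  | var y =>
    rintro ⟨C, a, b, hab, e, -⟩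
    cases C with
    | hole => cases e; exact R.not_calcRoot_var y b hab
    | appL C r => cases e
    | appR r C => cases e
  | app s t ihs iht =>
    by_cases h : ∃ u, R.CalcRoot (app (R.calcNF s) (R.calcNF t)) u
    · obtain ⟨r, hr⟩ := h
      rw [R.calcNF_app_of_calcRoot hr]
      obtain ⟨a, b, ⟨-, -, -, -, -, -, ⟨f, rfl, -⟩, -⟩, -, rfl⟩ := hr
      exact hsym (.inl f) u
    · rw [R.calcNF_app_of_not_calcRoot (not_exists.1 h)]
      rintro ⟨C, a, b, hab, e, -⟩
      cases C with
      | hole => cases e; exact h ⟨b, hab⟩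
      | appL C r =>
        obtain ⟨e, -⟩ := PreTerm.app.inj e
        exact ihs _ ⟨C, a, b, hab, e, rfl⟩
      | appR r C =>
        obtain ⟨-, e⟩ := PreTerm.app.inj e
        exact iht _ ⟨C, a, b, hab, e, rfl⟩

theorem isCalcNF_calcNF (R : LCSTRS.{u, v, w, x} S F V) (t : PreTerm R.SharpSym V) :
    R.IsCalcNF t (R.calcNF t) :=
  ⟨R.sharpCalcs_calcNF t, R.not_sharpCalc_calcNF t⟩

/-- A calculation redex has base type, so a theory symbol that still expects an argument is not one,
nor is any shorter application. -/
theorem calcNF_apps_values (R : LCSTRS.{u, v, w, x} S F V) {f : F} {vs : List (PreTerm F V)}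
    (hvs : ∀ c ∈ vs, R.IsValue c) {A B : Ty S} {g : (Ty.arrow A B).denote R.Dom}
    (h : R.Eval (apps (sym f) vs) (.arrow A B) g) :
    R.calcNF (R.emb (apps (sym f) vs)) = R.emb (apps (sym f) vs) := by
  induction vs using List.reverseRecOn generalizing A B with
  | nil => rfl
  | append_singleton vs c ih =>
    rw [apps_snoc] at h ⊢
    have hev := h
    cases h with
    | app h₀ h₁ =>
      have e₀ := ih (fun c hc => hvs c (List.mem_append_left _ hc)) h₀
      obtain ⟨k, rfl, -⟩ := hvs c (by simp)
      change R.calcNF (app (R.emb (apps (sym f) vs)) (R.emb (sym k))) = _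
      rw [calcNF_app_of_not_calcRoot, e₀]
      · rfl
      · rw [e₀]
        rintro u ⟨a, b, ⟨-, -, -, -, -, -, -, s, d, ha, -⟩, e, -⟩
        cases R.emb_inj (s := app (apps (sym f) vs) (sym k)) e
        cases hasType_unique (R.hasTy_of_eval ha) (R.hasTy_of_eval hev)

/-- Innermost normalization leaves the function part and the last argument of the redex unchanged,
so exactly the root step fires. -/
theorem calcNF_of_calcStep (R : LCSTRS.{u, v, w, x} S F V) {a b : PreTerm F V}
    (h : R.CalcStep a b) : R.calcNF (R.emb a) = R.emb b := by
  have hab := h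
  obtain ⟨f, hf, vs, hvs, hvs', rfl, -, s, d, ha, -⟩ := h
  obtain ⟨us, c, rfl⟩ := List.eq_nil_or_concat vs |>.resolve_left hvs
  rw [List.concat_eq_append] at hvs' ha hab ⊢
  rw [apps_snoc] at ha hab ⊢
  cases ha with
  | app h₀ h₁ =>
    have e₀ := R.calcNF_apps_values (fun c hc => hvs' c (List.mem_append_left _ hc)) h₀
    obtain ⟨k, rfl, -⟩ := hvs' c (by simp)
    refine R.calcNF_app_of_calcRoot (s := R.emb (apps (sym f) us)) (t := R.emb (sym k)) ?_
    rw [e₀]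
    exact ⟨_, b, hab, rfl, rfl⟩

theorem calcNF_app_congr (R : LCSTRS.{u, v, w, x} S F V) {s s' t t' : PreTerm R.SharpSym V}
    (h : R.calcNF s = R.calcNF s') (h' : R.calcNF t = R.calcNF t') :
    R.calcNF (app s t) = R.calcNF (app s' t') := by
  rw [calcNF, calcNF, h, h']

/-- A term contains a symbol that is not a theory symbol. -/
def HasNonTheorySym (R : LCSTRS.{u, v, w, x} S F V) (t : PreTerm R.SharpSym V) : Prop :=
  ¬ t.syms ⊆ Sum.inl '' R.theorySyms

theorem emb_syms (R : LCSTRS.{u, v, w, x} S F V) (t : PreTerm F V) :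
    (R.emb t).syms = Sum.inl '' t.syms := by
  induction t with
  | sym f => exact Set.image_singleton.symm
  | var y => exact Set.image_empty _ |>.symm
  | app s t ihs iht =>
    change (R.emb s).syms ∪ (R.emb t).syms = Sum.inl '' (s.syms ∪ t.syms)
    rw [Set.image_union, ihs, iht]

theorem HasNonTheorySym.not_calcRoot {R : LCSTRS.{u, v, w, x} S F V} {t : PreTerm R.SharpSym V}
    (h : R.HasNonTheorySym t) (u : PreTerm R.SharpSym V) : ¬ R.CalcRoot t u := by
  rintro ⟨a, b, ⟨-, -, -, -, -, -, -, s, d, ha, -⟩, rfl, -⟩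
  rw [HasNonTheorySym, R.emb_syms] at h
  exact h (Set.image_mono (R.syms_vars_of_eval ha).1)

theorem hasNonTheorySym_app (R : LCSTRS.{u, v, w, x} S F V) {s t : PreTerm R.SharpSym V} :
    R.HasNonTheorySym (app s t) ↔ R.HasNonTheorySym s ∨ R.HasNonTheorySym t := by
  rw [HasNonTheorySym, syms, Set.union_subset_iff, not_and_or]
  rfl

/-- Calculations consume theory symbols only, so a non-theory symbol is never erased and keeps
blocking calculation at every application above it. -/
theorem HasNonTheorySym.calcNF {R : LCSTRS.{u, v, w, x} S F V} {t : PreTerm R.SharpSym V}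
    (h : R.HasNonTheorySym t) : R.HasNonTheorySym (R.calcNF t) := by
  induction t with
  | sym f => exact h
  | var y => exact h
  | app s t ihs iht =>
    have := R.hasNonTheorySym_app.2 ((R.hasNonTheorySym_app.1 h).imp ihs iht)
    rwa [R.calcNF_app_of_not_calcRoot this.not_calcRoot]

theorem HasNonTheorySym.calcNF_app {R : LCSTRS.{u, v, w, x} S F V} {s t : PreTerm R.SharpSym V}
    (h : R.HasNonTheorySym (app s t)) :
    R.calcNF (app s t) = app (R.calcNF s) (R.calcNF t) :=
  R.calcNF_app_of_not_calcRoot fun u =>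
    (R.hasNonTheorySym_app.2 ((R.hasNonTheorySym_app.1 h).imp
      HasNonTheorySym.calcNF HasNonTheorySym.calcNF)).not_calcRoot u

/-! ## Typing of terms with marked symbols -/

theorem sharpHasTy_emb (R : LCSTRS.{u, v, w, x} S F V) {t : PreTerm F V} {A : Ty S}
    (h : R.HasTy t A) : R.SharpHasTy (R.emb t) A.lift := by
  induction h with
  | sym f => exact .sym (Sum.inl f)
  | var y => exact .var y
  | app _ _ h₀ h₁ => exact .app h₀ h₁

theorem sharpHasTy_subst (R : LCSTRS.{u, v, w, x} S F V) {σ : V → PreTerm F V}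
    (hσ : R.IsSubst σ) {t : PreTerm R.SharpSym V} {A : Ty (Option S)} (h : R.SharpHasTy t A) :
    R.SharpHasTy (R.sharpSubst σ t) A :=
  hasType_subst (fun y => R.sharpHasTy_emb (hσ y)) h

theorem hasType_fill {T : Type u} {G : Type v} {W : Type w} {symTy : G → Ty T} {varTy : W → Ty T}
    {a b : PreTerm G W} (hab : ∀ A, HasType symTy varTy a A → HasType symTy varTy b A)
    (C : Ctx G W) {A : Ty T} (h : HasType symTy varTy (C.fill a) A) :
    HasType symTy varTy (C.fill b) A := by
  induction C generalizing A with
  | hole => exact hab A h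
  | appL C u ih =>
    cases h with
    | app h₀ h₁ => exact .app (ih h₀) h₁
  | appR u C ih =>
    cases h with
    | app h₀ h₁ => exact .app h₀ (ih h₁)

theorem sharpHasTy_of_root (R : LCSTRS.{u, v, w, x} S F V) {a b : PreTerm F V}
    (h : R.RuleStep a b ∨ R.CalcStep a b) (A : Ty (Option S)) (ha : R.SharpHasTy (R.emb a) A) :
    R.SharpHasTy (R.emb b) A := by
  have : ∃ B, R.HasTy a B ∧ R.HasTy b B := by
    rcases h with ⟨ρ, hρ, σ, hσ, -, rfl, rfl⟩ | ⟨f, -, vs, -, -, -, -, s, c, h₁, h₂⟩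
    · obtain ⟨B, h₁, h₂⟩ := (R.isRule ρ hρ).same_type
      exact ⟨B, R.hasTy_subst hσ h₁, R.hasTy_subst hσ h₂⟩
    · exact ⟨_, R.hasTy_of_eval h₁, R.hasTy_of_eval h₂⟩
  obtain ⟨B, h₁, h₂⟩ := this
  cases hasType_unique ha (R.sharpHasTy_emb h₁)
  exact R.sharpHasTy_emb h₂

theorem sharpHasTy_of_sharpRew (R : LCSTRS.{u, v, w, x} S F V) {s t : PreTerm R.SharpSym V}
    (h : R.SharpRew s t) {A : Ty (Option S)} (hs : R.SharpHasTy s A) : R.SharpHasTy t A := by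
  obtain ⟨C, _, _, ⟨a, b, hab, rfl, rfl⟩, rfl, rfl⟩ := h
  exact hasType_fill (R.sharpHasTy_of_root hab) C hs

theorem sharpRew_of_sharpCalc (R : LCSTRS.{u, v, w, x} S F V) {s t : PreTerm R.SharpSym V}
    (h : R.SharpCalc s t) : R.SharpRew s t := by
  obtain ⟨C, _, _, ⟨a, b, hab, rfl, rfl⟩, rfl, rfl⟩ := h
  exact ⟨C, _, _, ⟨a, b, .inr hab, rfl, rfl⟩, rfl, rfl⟩

theorem sharpHasTy_calcNF (R : LCSTRS.{u, v, w, x} S F V) {t : PreTerm R.SharpSym V}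
    {A : Ty (Option S)} (h : R.SharpHasTy t A) : R.SharpHasTy (R.calcNF t) A := by
  have h' := R.sharpCalcs_calcNF t
  generalize R.calcNF t = t' at h'
  induction h' with
  | refl => exact h
  | tail _ h ih => exact R.sharpHasTy_of_sharpRew (R.sharpRew_of_sharpCalc h) ih

/-! ## Reduction pair processors -/

/-- A relation over terms, seen as a relation over pre-terms of the same type. -/
def TypedRel (R : LCSTRS.{u, v, w, x} S F V) (r : R.SharpTerm → R.SharpTerm → Prop)
    (s t : PreTerm R.SharpSym V) : Prop :=
  ∃ (A : Ty (Option S)) (hs : R.SharpHasTy s A) (ht : R.SharpHasTy t A), r ⟨s, A, hs⟩ ⟨t, A, ht⟩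

/-- Covering is required of all κ-normal forms, so it applies to the ones given by `calcNF`. -/
theorem Covers.typedRel {R : LCSTRS.{u, v, w, x} S F V} {r : R.SharpTerm → R.SharpTerm → Prop}
    {K : R.ConstrainedRel} (h : R.Covers r K) {s t : PreTerm R.SharpSym V} {φ : PreTerm F V}
    {L : Set V} (hK : K.rel s t φ L) {σ : V → PreTerm F V} (hσ : R.RespectsOn φ L σ) :
    R.TypedRel r (R.calcNF (R.sharpSubst σ s)) (R.calcNF (R.sharpSubst σ t)) := by
  obtain ⟨A, hs, ht⟩ := K.same_type s t φ L hK
  exact ⟨A, R.sharpHasTy_calcNF (R.sharpHasTy_subst hσ.1 hs),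
    R.sharpHasTy_calcNF (R.sharpHasTy_subst hσ.1 ht),
    h s t φ L hK σ hσ _ _ (R.isCalcNF_calcNF _) (R.isCalcNF_calcNF _)⟩

theorem Monotonic.typedRel_fill {R : LCSTRS.{u, v, w, x} S F V}
    {r : R.SharpTerm → R.SharpTerm → Prop} (h : R.Monotonic r) (C : Ctx R.SharpSym V)
    {s t : PreTerm R.SharpSym V} (hst : Relation.ReflTransGen (R.TypedRel r) s t)
    {A : Ty (Option S)} (hC : R.SharpHasTy (C.fill s) A) :
    Relation.ReflTransGen (R.TypedRel r) (C.fill s) (C.fill t) := by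
  suffices H : Relation.ReflTransGen (R.TypedRel r) (C.fill s) (C.fill t) ∧
    R.SharpHasTy (C.fill t) A from H.1
  induction hst with
  | refl => exact ⟨.refl, hC⟩
  | tail _ h₁ ih =>
    obtain ⟨B, hs, ht, hr⟩ := h₁
    have hty := hasType_fill (fun A' hA' => hasType_unique hA' hs ▸ ht) C ih.2
    exact ⟨ih.1.tail ⟨A, ih.2, hty, h C _ _ _ _ B hs ht rfl rfl hr⟩, hty⟩

theorem typedRel_of_sharpCalcs (R : LCSTRS.{u, v, w, x} S F V)
    {r : R.SharpTerm → R.SharpTerm → Prop} (h : ∀ s t : R.SharpTerm, R.SharpCalc s t → r s t)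
    {s t : PreTerm R.SharpSym V} (hst : Relation.ReflTransGen R.SharpCalc s t)
    {A : Ty (Option S)} (hs : R.SharpHasTy s A) : Relation.ReflTransGen (R.TypedRel r) s t := by
  suffices H : Relation.ReflTransGen (R.TypedRel r) s t ∧ R.SharpHasTy t A from H.1
  induction hst with
  | refl => exact ⟨.refl, hs⟩
  | tail _ h₁ ih =>
    have hty := R.sharpHasTy_of_sharpRew (R.sharpRew_of_sharpCalc h₁) ih.2
    exact ⟨ih.1.tail ⟨A, ih.2, hty, h _ _ h₁⟩, hty⟩

/-- Weak orientation of the rules is inherited by rewriting, up to normal forms with respect to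
calculation. -/
theorem typedRel_calcNF_of_sharpRew (R : LCSTRS.{u, v, w, x} S F V)
    {r : R.SharpTerm → R.SharpTerm → Prop} (hm : R.Monotonic r)
    (hκ : ∀ s t : R.SharpTerm, R.SharpCalc s t → r s t)
    (hrule : ∀ a b, R.RuleStep a b → R.TypedRel r (R.calcNF (R.emb a)) (R.calcNF (R.emb b)))
    {s t : PreTerm R.SharpSym V} (h : R.SharpRew s t) {A : Ty (Option S)}
    (hs : R.SharpHasTy s A) :
    Relation.ReflTransGen (R.TypedRel r) (R.calcNF s) (R.calcNF t) := by
  -- The invariant for the induction on the context: a calculation leaves the normal form unchanged,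
  -- and for a rule step the non-theory symbol lets normalization of the source pass through the
  -- context.
  suffices H : R.calcNF s = R.calcNF t ∨ R.HasNonTheorySym s ∧
      Relation.ReflTransGen (R.TypedRel r) (R.calcNF s) (R.calcNF t) by
    rcases H with H | H
    · rw [H]
    · exact H.2
  obtain ⟨C, _, _, ⟨a, b, hab, rfl, rfl⟩, rfl, rfl⟩ := h
  have hroot := R.sharpHasTy_of_root hab
  induction C generalizing A with
  | hole =>
    rcases hab with hab | hab
    · refine .inr ⟨?_, .single (hrule a b hab)⟩
      obtain ⟨ρ, hρ, σ, -, -, rfl, -⟩ := hab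
      obtain ⟨f, hf, hf'⟩ := (R.isRule ρ hρ).non_theory
      intro hsub
      rw [Ctx.fill, R.emb_syms] at hsub
      obtain ⟨g, hg, e⟩ := hsub ⟨f, syms_subset_subst σ _ hf, rfl⟩
      exact hf' (Sum.inl_injective e ▸ hg)
    · refine .inl ?_
      have hb : R.calcNF (R.emb b) = R.emb b := by
        obtain ⟨-, -, -, -, -, -, ⟨f, rfl, -⟩, -⟩ := hab
        rfl
      exact (R.calcNF_of_calcStep hab).trans hb.symm
  | appL C u ih =>
    have hs' := R.sharpHasTy_calcNF hs
    cases hs with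
    | app h₀ h₁ =>
      rcases ih h₀ with e | ⟨hn, hr⟩
      · exact .inl (R.calcNF_app_congr e rfl)
      · have hn' := R.hasNonTheorySym_app.2 (.inl (b := R.HasNonTheorySym u) hn)
        refine .inr ⟨hn', ?_⟩
        have e := hn'.calcNF_app
        change R.SharpHasTy (R.calcNF (app _ _)) _ at hs'
        change Relation.ReflTransGen _ (R.calcNF (app _ _)) (R.calcNF (app _ _))
        rw [e] at hs' ⊢
        -- The target may have lost its non-theory symbol, so its root can become a calculation
        -- redex; the second half covers this by κ-steps, which the weak relation includes.
        refine (hm.typedRel_fill (.appL .hole (R.calcNF u)) hr hs').trans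
          (R.typedRel_of_sharpCalcs hκ (R.sharpCalcs_app_calcNF _ _)
            (A := A) (.app (R.sharpHasTy_calcNF (hasType_fill hroot C h₀)) (R.sharpHasTy_calcNF h₁)))
  | appR u C ih =>
    have hs' := R.sharpHasTy_calcNF hs
    cases hs with
    | app h₀ h₁ =>
      rcases ih h₁ with e | ⟨hn, hr⟩
      · exact .inl (R.calcNF_app_congr rfl e)
      · have hn' := R.hasNonTheorySym_app.2 (.inr (a := R.HasNonTheorySym u) hn)
        refine .inr ⟨hn', ?_⟩
        have e := hn'.calcNF_app
        change R.SharpHasTy (R.calcNF (app _ _)) _ at hs'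
        change Relation.ReflTransGen _ (R.calcNF (app _ _)) (R.calcNF (app _ _))
        rw [e] at hs' ⊢
        refine (hm.typedRel_fill (.appR (R.calcNF u) .hole) hr hs').trans
          (R.typedRel_of_sharpCalcs hκ (R.sharpCalcs_app_calcNF _ _)
            (A := A) (.app (R.sharpHasTy_calcNF h₀) (R.sharpHasTy_calcNF (hasType_fill hroot C h₁))))

theorem typedRel_calcNF_of_sharpRews (R : LCSTRS.{u, v, w, x} S F V)
    {r : R.SharpTerm → R.SharpTerm → Prop} (hm : R.Monotonic r)
    (hκ : ∀ s t : R.SharpTerm, R.SharpCalc s t → r s t)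
    (hrule : ∀ a b, R.RuleStep a b → R.TypedRel r (R.calcNF (R.emb a)) (R.calcNF (R.emb b)))
    {s t : PreTerm R.SharpSym V} (h : Relation.ReflTransGen R.SharpRew s t) {A : Ty (Option S)}
    (hs : R.SharpHasTy s A) :
    Relation.ReflTransGen (R.TypedRel r) (R.calcNF s) (R.calcNF t) := by
  suffices H : Relation.ReflTransGen (R.TypedRel r) (R.calcNF s) (R.calcNF t) ∧
    R.SharpHasTy t A from H.1
  induction h with
  | refl => exact ⟨.refl, hs⟩
  | tail _ h₁ ih =>
    exact ⟨ih.1.trans (R.typedRel_calcNF_of_sharpRew hm hκ hrule h₁ ih.2),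
      R.sharpHasTy_of_sharpRew h₁ ih.2⟩

/-- Weak steps followed by a strict step can be replaced by strict steps. -/
theorem transGen_typedRel (R : LCSTRS.{u, v, w, x} S F V) {sq sqs : R.SharpTerm → R.SharpTerm → Prop}
    (h : ∀ s t r, sq s t → sqs t r → Relation.TransGen sqs s r) {s t r : R.SharpTerm}
    (hst : Relation.ReflTransGen (R.TypedRel sq) s.1 t.1) (htr : sqs t r) :
    Relation.TransGen sqs s r := by
  have key : ∀ s t r : R.SharpTerm, sq s t → Relation.TransGen sqs t r →
      Relation.TransGen sqs s r := by
    intro s t r hst htr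
    induction htr with
    | single h' => exact h _ _ _ hst h'
    | tail _ h' ih => exact ih.tail h'
  generalize e : t.1 = t' at hst
  generalize e' : s.1 = s' at hst
  induction hst using Relation.ReflTransGen.head_induction_on generalizing s with
  | refl => cases Subtype.ext (e'.trans e.symm); exact .single htr
  | head h₁ _ ih =>
    obtain ⟨A, ha, hb, hr⟩ := h₁
    subst e'
    exact key _ ⟨_, A, hb⟩ _ hr (ih rfl)

theorem IsReductionPairProcessor.sound {R : LCSTRS.{u, v, w, x} S F V} {ρ : R.Processor}
    (h : R.IsReductionPairProcessor ρ) (o : SortOrdering S) : R.Sound o ρ := by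
  rintro P Q hPQ hQ ⟨c, hc, hc'⟩
  obtain ⟨P', -, -, ⟨geq, gt, ⟨sq, sqs, hsq, -, hκ, hm, hsqs, hwf, hcomp⟩, hgt, hgeq, hrules⟩, rfl⟩ :=
    h P Q hPQ
  have hinf := (hQ _ rfl).exists_mem hc hc'
  obtain ⟨h₀, h₁⟩ := R.isChain_top.1 hc
  have hrule : ∀ a b, R.RuleStep a b →
      R.TypedRel sq (R.calcNF (R.emb a)) (R.calcNF (R.emb b)) := by
    rintro _ _ ⟨π, hπ, σ, hσ, hresp, rfl, rfl⟩
    rw [← R.emb_subst, ← R.emb_subst]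
    exact hsq.typedRel (hrules π hπ)
      ⟨hσ, fun y hy => R.isGroundTheoryTerm_of_isValue (hresp.1 y hy), hresp.2⟩
  let l : ℕ → PreTerm R.SharpSym V := fun i => R.calcNF (R.sharpSubst (c i).2 (c i).1.lhs.toTerm)
  let r : ℕ → PreTerm R.SharpSym V := fun i => R.calcNF (R.sharpSubst (c i).2 (c i).1.rhs.toTerm)
  have hlt : ∀ i, (c i).1 ∈ P' → R.TypedRel sqs (l i) (r i) := fun i hi =>
    hsqs.typedRel (hgt _ hi) (h₀ i).2
  have hle : ∀ i, (c i).1 ∉ P' → R.TypedRel sq (l i) (r i) := fun i hi =>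
    hsq.typedRel (hgeq _ ⟨(h₀ i).1, hi⟩) (h₀ i).2
  have hrl : ∀ i, Relation.ReflTransGen (R.TypedRel sq) (r i) (l (i + 1)) := by
    intro i
    have : ∃ A, R.SharpHasTy (c i).1.rhs.toTerm A := by
      by_cases hi : (c i).1 ∈ P'
      · obtain ⟨A, -, h⟩ := gt.same_type _ _ _ _ (hgt _ hi)
        exact ⟨A, h⟩
      · obtain ⟨A, -, h⟩ := geq.same_type _ _ _ _ (hgeq _ ⟨(h₀ i).1, hi⟩)
        exact ⟨A, h⟩
    obtain ⟨A, hA⟩ := this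
    exact R.typedRel_calcNF_of_sharpRews hm hκ hrule (h₁ i) (R.sharpHasTy_subst (h₀ i).2.1 hA)
  have hnext : ∀ i, ∃ m, i < m ∧ (c m).1 ∈ P' ∧
      Relation.ReflTransGen (R.TypedRel sq) (r i) (l m) := by
    intro i
    by_contra! H
    obtain ⟨m, him, hm'⟩ := hinf (i + 1)
    -- If no pair of `P'` were reachable from `r i`, every later pair would be oriented weakly, so
    -- every later left-hand side would be reachable, including one of a pair in `P'`.
    have hno : ∀ k, i + 1 ≤ k → Relation.ReflTransGen (R.TypedRel sq) (r i) (l k) := by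
      intro k hk
      induction k, hk using Nat.le_induction with
      | base => exact hrl i
      | succ k hk ih => exact (ih.tail (hle k fun hP => H k hk hP ih)).trans (hrl k)
    exact H m him hm' (hno m him)
  have hacc : ∀ y : R.SharpTerm, ∀ i, r i = y.1 → False := by
    intro y
    -- Absorbing weak steps yields at least one strict step, not exactly one, so the descent runs in
    -- the transitive closure.
    induction (hwf.apply y).transGen with
    | intro y _ ih =>
      intro i hi
      obtain ⟨m, -, hm', hr⟩ := hnext i
      obtain ⟨A, hl, hr', hs⟩ := hlt m hm'
      refine ih ⟨r m, A, hr'⟩ (Relation.transGen_swap.2 ?_) m rfl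
      exact R.transGen_typedRel hcomp (t := ⟨l m, A, hl⟩) (hi ▸ hr) hs
  obtain ⟨m, -, hm'⟩ := hinf 0
  obtain ⟨A, -, hr, -⟩ := hlt m hm'
  exact hacc ⟨r m, A, hr⟩ m rfl

end LCSTRS

-- Soundness of the five classes of processors

theorem mainTheorem2 {S : Type u} {F : Type v} {V : Type w} (R : LCSTRS.{u, v, w, x} S F V)
    (o : SortOrdering S) (ρ : R.Processor) :
    (R.IsGraphProcessor ρ → R.Sound o ρ) ∧
    (R.IsSubtermProcessor ρ → R.Sound o ρ) ∧
    (∀ Z : R.IntTheory, R.IsIntProcessor Z ρ → R.Sound o ρ) ∧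
    (R.IsTheoryArgProcessor ρ → R.Sound o ρ) ∧
    (R.IsReductionPairProcessor ρ → R.Sound o ρ) :=
  ⟨fun h => h.sound o, fun h => h.sound o, fun _ h => h.sound o, fun h => h.sound o,
    fun h => h.sound o⟩
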